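/- For a positive integer $n$, let $L_n$ be the number of Latin squares of order $n$, that is, of $n\times n$ matrices with entries in $[n]=\{1,\dots,n\}$ in which every symbol appears exactly once in every row and in every column. Let $\Omega^{(2)}_n$ be the polytope of tristochastic arrays of order $n$: the $n\times n\times n$ arrays of nonnegative reals in which every line (the set of $n$ entries obtained by fixing two of the indices and letting the third vary) sums to $1$. Then $\Omega^{(2)}_n$ has at least $L_n^{\frac32-o(1)}$ vertices; that is, there is a real sequence $\varepsilon_n\to 0$ such that, for every $n$, the number $v_n$ of vertices of $\Omega^{(2)}_n$ satisfies $v_n\ge L_n^{\frac32-\varepsilon_n}$. Moreover, identify a Latin square $L$ with the array $A$ given by $A(i,j,k)=1$ if $L(i,j)=k$ and $A(i,j,k)=0$ otherwise. Then every Latin square of order $n$ is a vertex of $\Omega^{(2)}_n$, and the proportion of Latin squares among the vertices of $\Omega^{(2)}_n$ tends to $0$ as $n\to\infty$. -/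

import Mathlib

/-- An `n × n` matrix with entries in `[n]` is a Latin square if every symbol appears exactly once
in every row and exactly once in every column. -/
def IsLatinSquare {n : ℕ} (L : Fin n → Fin n → Fin n) : Prop :=
  (∀ i k, ∃! j, L i j = k) ∧ (∀ j k, ∃! i, L i j = k)

/-- `L_n`, the number of Latin squares of order `n`. -/
noncomputable def latinSquareCount (n : ℕ) : ℕ :=
  Set.ncard {L : Fin n → Fin n → Fin n | IsLatinSquare L}

/-- The polytope of tristochastic arrays of order `n`: nonnegative real `n × n × n` arrays in which
every line (two indices fixed, the third one varying) sums to `1`. -/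
def tristochasticPolytope (n : ℕ) : Set (Fin n → Fin n → Fin n → ℝ) :=
  {A | (∀ i j k, 0 ≤ A i j k) ∧
    (∀ j k, ∑ i, A i j k = 1) ∧ (∀ i k, ∑ j, A i j k = 1) ∧ (∀ i j, ∑ k, A i j k = 1)}

/-- The vertices of the polytope of tristochastic arrays. -/
def tristochasticVertices (n : ℕ) : Set (Fin n → Fin n → Fin n → ℝ) :=
  (tristochasticPolytope n).extremePoints ℝ

/-- The zero-one array of a matrix `L` with entries in `[n]`: its `(i, j, k)` entry is `1` exactly
when `L i j = k`. -/
def toArray {n : ℕ} (L : Fin n → Fin n → Fin n) : Fin n → Fin n → Fin n → ℝ :=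
  fun i j k => if L i j = k then 1 else 0

/-- The set of Latin squares of order `n`, viewed as zero-one arrays. -/
def latinSquareArrays (n : ℕ) : Set (Fin n → Fin n → Fin n → ℝ) :=
  toArray '' {L | IsLatinSquare L}

/-! ### Mixed permanents. -/

/-- The mixed permanent of a list of vectors on the rows in `S`: the permanent of the matrix with
these columns when the list has as many entries as `S`. -/
def mixedPer {ι : Type*} [DecidableEq ι] : List (ι → ℝ) → Finset ι → ℝ
  | [], _ => 1
  | c :: cs, S => ∑ i ∈ S, c i * mixedPer cs (S.erase i)

section MixedPer

variable {ι : Type*} [DecidableEq ι]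

theorem mixedPer_cons (c : ι → ℝ) (cs : List (ι → ℝ)) (S : Finset ι) :
    mixedPer (c :: cs) S = ∑ i ∈ S, c i * mixedPer cs (S.erase i) := rfl

theorem mixedPer_swap (a b : ι → ℝ) (cs : List (ι → ℝ)) (S : Finset ι) :
    mixedPer (a :: b :: cs) S = mixedPer (b :: a :: cs) S := by
  simp only [mixedPer_cons, Finset.mul_sum]
  rw [Finset.sum_comm' (t' := S) (s' := fun j => S.erase j)]
  · refine Finset.sum_congr rfl fun j _ => Finset.sum_congr rfl fun i _ => ?_
    rw [Finset.erase_right_comm]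
    ring
  · intro x y
    simp only [Finset.mem_erase]
    tauto

theorem mixedPer_perm {l l' : List (ι → ℝ)} (h : l.Perm l') :
    ∀ S : Finset ι, mixedPer l S = mixedPer l' S := by
  induction h with
  | nil => intro S; rfl
  | cons c _ ih => intro S; simp only [mixedPer_cons, ih]
  | swap a b l => intro S; exact mixedPer_swap _ _ _ _
  | trans _ _ ih₁ ih₂ => intro S; rw [ih₁, ih₂]

theorem mixedPer_add (a b : ι → ℝ) (cs : List (ι → ℝ)) (S : Finset ι) :
    mixedPer ((a + b) :: cs) S = mixedPer (a :: cs) S + mixedPer (b :: cs) S := by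
  simp only [mixedPer_cons, Pi.add_apply, add_mul, Finset.sum_add_distrib]

theorem mixedPer_smul (t : ℝ) (a : ι → ℝ) (cs : List (ι → ℝ)) (S : Finset ι) :
    mixedPer ((t • a) :: cs) S = t * mixedPer (a :: cs) S := by
  simp only [mixedPer_cons, Pi.smul_apply, smul_eq_mul, Finset.mul_sum, mul_assoc]

/-- The expansion never runs out of rows while columns remain; surplus rows are harmless because the
empty list has value `1` on every set. -/
theorem mixedPer_pos : ∀ (cs : List (ι → ℝ)) (S : Finset ι),
    (∀ c ∈ cs, ∀ i ∈ S, 0 < c i) → cs.length ≤ S.card → 0 < mixedPer cs S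
  | [], S, _, _ => one_pos
  | c :: cs, S, hc, hl => by
    rw [mixedPer_cons]
    simp only [List.length_cons] at hl
    refine Finset.sum_pos (fun i hi => mul_pos (hc c (by simp) i hi) ?_)
      (Finset.card_pos.mp (by omega))
    refine mixedPer_pos cs _ (fun d hd j hj => hc d (by simp [hd]) j (Finset.mem_of_mem_erase hj)) ?_
    rw [Finset.card_erase_of_mem hi]
    omega

end MixedPer

/-! ### The Bochner method and the Alexandrov–Fenchel inequality. -/

/-- A symmetric matrix with positive off-diagonal entries that satisfies the Bochner-type inequality
`∑ (Q x)_i² / p_i ≥ xᵀ Q x`, where `p_i = (Q v)_i / v_i`, is negative semidefinite on the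
`Q`-orthogonal complement of `v`. -/
theorem quadraticForm_nonpos_of_bochner {κ : Type*} [Fintype κ] [DecidableEq κ]
    (Q : κ → κ → ℝ) (hsymm : ∀ i j, Q i j = Q j i) (hpos : ∀ i j, i ≠ j → 0 < Q i j)
    (v p : κ → ℝ) (hv : ∀ i, 0 < v i) (hp : ∀ i, 0 < p i)
    (hpv : ∀ i, ∑ j, Q i j * v j = p i * v i)
    (hB : ∀ x : κ → ℝ, ∑ i, x i * ∑ j, Q i j * x j ≤ ∑ i, (∑ j, Q i j * x j) ^ 2 / p i)
    (x : κ → ℝ) (hx : ∑ i, x i * ∑ j, Q i j * v j = 0) :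
    ∑ i, x i * ∑ j, Q i j * x j ≤ 0 := by
  classical
  set s : κ → ℝ := fun i => Real.sqrt (p i) with hs
  have hs0 : ∀ i, 0 < s i := fun i => Real.sqrt_pos.mpr (hp i)
  have hss : ∀ i, s i * s i = p i := fun i => Real.mul_self_sqrt (hp i).le
  -- Rescaling by `√p` turns the generalized eigenproblem `Q y = λ p y` into one for a symmetric
  -- matrix; `v` solves it with `λ = 1`.
  set M : Matrix κ κ ℝ := Matrix.of fun i j => Q i j / (s i * s j) with hM
  have hherm : M.IsHermitian := by
    ext i j
    simp [hM, hsymm i j, mul_comm]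
  -- the quadratic form is dominated by the diagonal one, with equality only along `v`
  have hperron : ∀ y : κ → ℝ, ∑ i, ∑ j, Q i j * v i * v j * (y i / v i - y j / v j) ^ 2
      = 2 * (∑ i, p i * y i ^ 2 - ∑ i, y i * ∑ j, Q i j * y j) := by
    intro y
    have h1 : ∀ i j, Q i j * v i * v j * (y i / v i - y j / v j) ^ 2
        = (y i ^ 2 / v i) * (Q i j * v j) + (y j ^ 2 / v j) * (Q j i * v i)
          - 2 * (y i * (Q i j * y j)) := by
      intro i j
      have := (hv i).ne'
      have := (hv j).ne'
      rw [hsymm j i]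
      field_simp
      ring
    simp only [h1, Finset.sum_sub_distrib, Finset.sum_add_distrib]
    rw [Finset.sum_comm (f := fun i j => (y j ^ 2 / v j) * (Q j i * v i))]
    simp only [← Finset.mul_sum, hpv]
    have : ∀ i, y i ^ 2 / v i * (p i * v i) = p i * y i ^ 2 := by
      intro i
      have := (hv i).ne'
      field_simp
    simp only [this]
    ring
  have hterm : ∀ (y : κ → ℝ) i j, 0 ≤ Q i j * v i * v j * (y i / v i - y j / v j) ^ 2 := by
    intro y i j
    by_cases h : i = j
    · subst h; simp
    · have := hpos i j h
      have := hv i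
      have := hv j
      positivity
  -- spectral decomposition
  set b := hherm.eigenvectorBasis with hb
  set lam := hherm.eigenvalues with hlam
  have hMb : ∀ k i, ∑ j, M i j * b k j = lam k * b k i := by
    intro k i
    have := congrFun (hherm.mulVec_eigenvectorBasis k) i
    simpa [Matrix.mulVec, dotProduct] using this
  set z : EuclideanSpace ℝ κ := WithLp.toLp 2 fun i => s i * x i with hz
  set Mz : EuclideanSpace ℝ κ := WithLp.toLp 2 fun i => ∑ j, M i j * z j with hMz
  have hform : ∑ i, x i * ∑ j, Q i j * x j = inner ℝ z Mz := by
    simp only [PiLp.inner_apply, hMz, hz, hM, Matrix.of_apply, RCLike.inner_apply, conj_trivial,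
      Finset.mul_sum, Finset.sum_mul]
    refine Finset.sum_congr rfl fun i _ => Finset.sum_congr rfl fun j _ => ?_
    have := (hs0 i).ne'
    have := (hs0 j).ne'
    field_simp
  rw [hform, ← b.sum_inner_mul_inner]
  refine Finset.sum_nonpos fun k _ => ?_
  have hbM : inner ℝ (b k) Mz = lam k * inner ℝ (b k) z := by
    simp only [PiLp.inner_apply, hMz, RCLike.inner_apply, conj_trivial, Finset.mul_sum,
      Finset.sum_mul]
    rw [Finset.sum_comm]
    refine Finset.sum_congr rfl fun j _ => ?_
    have : ∀ i, M i j * z j * b k i = z j * (M j i * b k i) := by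
      intro i
      have : M i j = M j i := by simpa using hherm.apply j i
      rw [this]; ring
    simp only [this, ← Finset.mul_sum, hMb]
    ring
  rw [hbM, real_inner_comm (b k) z]
  -- the eigenvector in the original coordinates
  set y : κ → ℝ := fun i => b k i / s i with hy
  have hQy : ∀ i, ∑ j, Q i j * y j = lam k * (p i * y i) := by
    intro i
    have h := hMb k i
    have e : ∑ j, Q i j * y j = s i * ∑ j, M i j * b k j := by
      rw [Finset.mul_sum]
      refine Finset.sum_congr rfl fun j _ => ?_
      have := (hs0 i).ne'
      have := (hs0 j).ne'
      simp only [hy, hM, Matrix.of_apply]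
      field_simp
    rw [e, h, ← hss i]
    have := (hs0 i).ne'
    simp only [hy]
    field_simp
  have hnorm : ∑ i, p i * y i ^ 2 = 1 := by
    have h1 : inner ℝ (b k) (b k) = (1 : ℝ) := by
      rw [real_inner_self_eq_norm_sq, b.norm_eq_one]; norm_num
    rw [← h1]
    simp only [PiLp.inner_apply, RCLike.inner_apply, conj_trivial]
    refine Finset.sum_congr rfl fun i _ => ?_
    have := (hs0 i).ne'
    rw [← hss i]
    simp only [hy]
    field_simp
  have hyQy : ∑ i, y i * ∑ j, Q i j * y j = lam k := by
    simp only [hQy]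
    have : ∀ i, y i * (lam k * (p i * y i)) = lam k * (p i * y i ^ 2) := fun i => by ring
    simp only [this, ← Finset.mul_sum, hnorm, mul_one]
  have hsq : ∑ i, (∑ j, Q i j * y j) ^ 2 / p i = lam k ^ 2 := by
    simp only [hQy]
    have : ∀ i, (lam k * (p i * y i)) ^ 2 / p i = lam k ^ 2 * (p i * y i ^ 2) := fun i => by
      have := (hp i).ne'
      field_simp
    simp only [this, ← Finset.mul_sum, hnorm, mul_one]
  -- At an eigenvector the Bochner inequality reads `λ ≤ λ²`, while the Perron identity gives `λ ≤
  -- 1`. A positive `λ` is therefore `1`; its eigenvectors are proportional to `v`, hence orthogonal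
  -- to `x`.
  have hle : lam k ≤ lam k ^ 2 := by
    have := hB y
    rwa [hyQy, hsq] at this
  have hP := hperron y
  rw [hnorm, hyQy] at hP
  have hP0 : 0 ≤ ∑ i, ∑ j, Q i j * v i * v j * (y i / v i - y j / v j) ^ 2 :=
    Finset.sum_nonneg fun i _ => Finset.sum_nonneg fun j _ => hterm y i j
  by_cases hl : lam k ≤ 0
  · nlinarith [sq_nonneg (inner ℝ (b k) z : ℝ)]
  have hl1 : lam k = 1 := by
    push Not at hl
    have : 1 ≤ lam k := by nlinarith
    linarith
  have hzero : ∑ i, ∑ j, Q i j * v i * v j * (y i / v i - y j / v j) ^ 2 = 0 := by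
    rw [hP, hl1]; ring
  have hconst : ∀ i j, y i / v i = y j / v j := by
    intro i j
    by_cases h : i = j
    · rw [h]
    have h1 := (Finset.sum_eq_zero_iff_of_nonneg
      (fun i _ => Finset.sum_nonneg fun j _ => hterm y i j)).mp hzero i (Finset.mem_univ i)
    have h2 := (Finset.sum_eq_zero_iff_of_nonneg (fun j _ => hterm y i j)).mp h1 j
      (Finset.mem_univ j)
    have h3 : Q i j * v i * v j ≠ 0 :=
      mul_ne_zero (mul_ne_zero (hpos i j h).ne' (hv i).ne') (hv j).ne'
    have h4 := (mul_eq_zero.mp h2).resolve_left h3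
    exact sub_eq_zero.mp (pow_eq_zero_iff (two_ne_zero) |>.mp h4)
  have hinner : (inner ℝ (b k) z : ℝ) = 0 := by
    simp only [PiLp.inner_apply, RCLike.inner_apply, conj_trivial]
    have e : ∀ i, z i * b k i = p i * x i * y i := by
      intro i
      have := (hs0 i).ne'
      rw [← hss i]
      simp only [hz, hy]
      field_simp
    simp only [e]
    rcases isEmpty_or_nonempty κ with hκ | ⟨⟨i₀⟩⟩
    · simp
    have e2 : ∀ i, p i * x i * y i = y i₀ / v i₀ * (x i * ∑ j, Q i j * v j) := by
      intro i
      rw [hpv, ← hconst i i₀]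
      have := (hv i).ne'
      field_simp
    simp only [e2, ← Finset.mul_sum, hx, mul_zero]
  rw [hinner]
  simp

section AlexandrovFenchel

variable {ι : Type*} [DecidableEq ι]

/-- The Alexandrov–Fenchel inequality for permanents. -/
theorem mixedPer_mul_le_sq : ∀ (cs : List (ι → ℝ)) (S : Finset ι), cs.length + 2 = S.card →
    (∀ c ∈ cs, ∀ i ∈ S, 0 < c i) → ∀ x y : ι → ℝ, (∀ i ∈ S, 0 < y i) →
    mixedPer (x :: x :: cs) S * mixedPer (y :: y :: cs) S ≤ mixedPer (x :: y :: cs) S ^ 2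
  | [], S, hS, _, x, y, hy => by
    obtain ⟨a, b, hab, rfl⟩ := Finset.card_eq_two.mp hS.symm
    have h1 : ({a, b} : Finset ι).erase a = {b} := by
      ext i; simp only [Finset.mem_erase, Finset.mem_insert, Finset.mem_singleton]
      constructor
      · tauto
      · rintro rfl; exact ⟨hab.symm, Or.inr rfl⟩
    have h2 : ({a, b} : Finset ι).erase b = {a} := by
      rw [Finset.pair_comm]
      ext i; simp only [Finset.mem_erase, Finset.mem_insert, Finset.mem_singleton]
      constructor
      · tauto
      · rintro rfl; exact ⟨hab, Or.inr rfl⟩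
    simp only [Finset.sum_pair hab, h1, h2, Finset.sum_singleton, mixedPer, mul_one]
    nlinarith [sq_nonneg (x a * y b - x b * y a)]
  | v :: cs, S, hS, hpos, x, y, hy => by
    simp only [List.length_cons] at hS
    have hv : ∀ i ∈ S, 0 < v i := hpos v (by simp)
    have hcs : ∀ c ∈ cs, ∀ i ∈ S, 0 < c i := fun c hc => hpos c (by simp [hc])
    have hcard : ∀ i ∈ S, (S.erase i).card = cs.length + 2 := fun i hi => by
      rw [Finset.card_erase_of_mem hi]; omega
    -- The matrix of the form `(z, w) ↦ M(z, w, v, cs)`. Its diagonal is zero because two columns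
    -- cannot use the same row.
    set Q : S → S → ℝ := fun i j =>
      if i = j then 0 else mixedPer (v :: cs) ((S.erase i).erase j) with hQ
    have hrow : ∀ (z : ι → ℝ) (i : S), mixedPer (z :: v :: cs) (S.erase i) = ∑ j, Q i j * z j := by
      intro z i
      have e : ∑ j, Q i j * z j = ∑ j ∈ S, (if (i : ι) = j then 0 else
          mixedPer (v :: cs) ((S.erase i).erase j)) * z j := by
        rw [← Finset.sum_coe_sort S]
        refine Finset.sum_congr rfl fun j _ => ?_
        simp only [hQ, Subtype.ext_iff]
      rw [e, mixedPer_cons, ← Finset.add_sum_erase S _ i.2]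
      simp only [if_true, zero_mul, zero_add]
      refine Finset.sum_congr rfl fun j hj => ?_
      rw [if_neg (Finset.ne_of_mem_erase hj).symm, mul_comm]
    have hform : ∀ z w : ι → ℝ,
        mixedPer (z :: w :: v :: cs) S = ∑ i : S, z i * ∑ j : S, Q i j * w j := by
      intro z w
      rw [mixedPer_cons, ← Finset.sum_coe_sort]
      exact Finset.sum_congr rfl fun i _ => by rw [hrow]
    have hsymm : ∀ i j, Q i j = Q j i := by
      intro i j
      simp only [hQ, eq_comm (a := i) (b := j), Finset.erase_right_comm (a := (i : ι))]
    have hQpos : ∀ i j, i ≠ j → 0 < Q i j := by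
      intro i j hij
      simp only [hQ, if_neg hij]
      refine mixedPer_pos _ _ (fun c hc k hk => hpos c hc k ?_) ?_
      · exact Finset.mem_of_mem_erase (Finset.mem_of_mem_erase hk)
      · rw [Finset.card_erase_of_mem (by
          simp only [Finset.mem_erase]
          exact ⟨fun h => hij (Subtype.ext h.symm), j.2⟩), hcard i i.2]
        simp
    have hrowpos : ∀ i : S, 0 < mixedPer (v :: v :: cs) (S.erase i) := fun i => by
      refine mixedPer_pos _ _ (fun c hc k hk => ?_) ?_
      · have hk := Finset.mem_of_mem_erase hk
        simp only [List.mem_cons] at hc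
        rcases hc with rfl | rfl | hc
        exacts [hv k hk, hv k hk, hcs c hc k hk]
      · rw [hcard i i.2]; simp
    set p : S → ℝ := fun i => mixedPer (v :: v :: cs) (S.erase i) / v i with hp
    have hppos : ∀ i, 0 < p i := fun i => div_pos (hrowpos i) (hv i i.2)
    have hpv : ∀ i : S, ∑ j, Q i j * v j = p i * v i := fun i => by
      rw [← hrow v i, hp, div_mul_cancel₀ _ (hv i i.2).ne']
    -- Expanding along the column `v` and applying the induction hypothesis to `z` and `v` on each
    -- minor gives the Bochner inequality termwise.
    have hB : ∀ z : S → ℝ,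
        ∑ i, z i * ∑ j, Q i j * z j ≤ ∑ i, (∑ j, Q i j * z j) ^ 2 / p i := by
      intro z'
      obtain ⟨z, rfl⟩ : ∃ z : ι → ℝ, z' = fun i : S => z i :=
        ⟨fun i => if h : i ∈ S then z' ⟨i, h⟩ else 0, by ext i; simp⟩
      rw [← hform z z, mixedPer_perm ((List.Perm.swap v z cs).cons z),
        mixedPer_swap, mixedPer_cons, ← Finset.sum_coe_sort]
      refine Finset.sum_le_sum fun i _ => ?_
      rw [← hrow z i, le_div_iff₀ (hppos i)]
      have ih := mixedPer_mul_le_sq cs (S.erase i) (hcard i i.2).symm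
        (fun c hc k hk => hcs c hc k (Finset.mem_of_mem_erase hk)) z v
        (fun k hk => hv k (Finset.mem_of_mem_erase hk))
      have : p i * v i = mixedPer (v :: v :: cs) (S.erase i) := by
        rw [hp, div_mul_cancel₀ _ (hv i i.2).ne']
      rw [← this] at ih
      linarith
    have hneg : ∀ z : ι → ℝ, mixedPer (z :: v :: v :: cs) S = 0 →
        mixedPer (z :: z :: v :: cs) S ≤ 0 := by
      intro z hz
      rw [hform] at hz ⊢
      exact quadraticForm_nonpos_of_bochner Q hsymm hQpos (fun i => v i) p (fun i => hv i i.2)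
        hppos hpv hB (fun i => z i) hz
    -- reverse Cauchy–Schwarz
    set α := mixedPer (x :: v :: v :: cs) S with hα
    set β := mixedPer (y :: v :: v :: cs) S with hβ
    have hβpos : 0 < β := by
      refine mixedPer_pos _ _ (fun c hc k hk => ?_) (by simp; omega)
      simp only [List.mem_cons] at hc
      rcases hc with rfl | rfl | rfl | hc
      exacts [hy k hk, hv k hk, hv k hk, hcs c hc k hk]
    have hyy : 0 < mixedPer (y :: y :: v :: cs) S := by
      refine mixedPer_pos _ _ (fun c hc k hk => ?_) (by simp; omega)
      simp only [List.mem_cons] at hc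
      rcases hc with rfl | rfl | rfl | hc
      exacts [hy k hk, hy k hk, hv k hk, hcs c hc k hk]
    have hw := hneg (β • x + (-α) • y) (by
      rw [mixedPer_add, mixedPer_smul, mixedPer_smul]
      rw [← hα, ← hβ]; ring)
    have hlin : ∀ z, mixedPer ((β • x + (-α) • y) :: z :: v :: cs) S
        = β * mixedPer (x :: z :: v :: cs) S - α * mixedPer (y :: z :: v :: cs) S := by
      intro z
      rw [mixedPer_add, mixedPer_smul, mixedPer_smul]; ring
    rw [hlin, mixedPer_swap x, mixedPer_swap y, hlin, hlin, mixedPer_swap y x] at hw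
    set X := mixedPer (x :: x :: v :: cs) S
    set Y := mixedPer (y :: y :: v :: cs) S
    set Z := mixedPer (x :: y :: v :: cs) S
    have h1 : Y * (β * (β * X - α * Z) - α * (β * Z - α * Y)) ≤ 0 :=
      mul_nonpos_of_nonneg_of_nonpos hyy.le hw
    -- The left side of `h1` equals `β² (XY - Z²) + (αY - βZ)²`.
    have h2 : β ^ 2 * (X * Y - Z ^ 2) ≤ 0 := by nlinarith [sq_nonneg (α * Y - β * Z)]
    have h3 : X * Y - Z ^ 2 ≤ 0 := by
      by_contra h
      push Not at h
      have : 0 < β ^ 2 * (X * Y - Z ^ 2) := by positivity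
      linarith
    linarith

/-- If `z = y + t a`, replacing `y` by `z` in the list decreases the ratio of the mixed permanents
with one further `a` and one further `y`. -/
theorem mixedPer_ratio_step (a y : ι → ℝ) (t : ℝ) (ht : 0 ≤ t) (cs : List (ι → ℝ)) (S : Finset ι)
    (hS : cs.length + 2 = S.card) (hcs : ∀ c ∈ cs, ∀ i ∈ S, 0 < c i) (hy : ∀ i ∈ S, 0 < y i) :
    mixedPer ((y + t • a) :: a :: cs) S * mixedPer (y :: y :: cs) S ≤
      mixedPer (a :: y :: cs) S * mixedPer ((y + t • a) :: y :: cs) S := by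
  simp only [mixedPer_add, mixedPer_smul]
  -- After expansion in `t` the constant terms agree, and the linear terms are compared by
  -- Alexandrov–Fenchel.
  have := mixedPer_mul_le_sq cs S hS hcs a y hy
  rw [mixedPer_swap y a]
  nlinarith

/-- Each replacement of a `y` by `y + t a` can only lower the ratio `M(a, …) / M(y, …)`, so
induction compares it with its value at no replacements. The cross-multiplied form avoids division.
-/
theorem mixedPer_ratio (a y : ι → ℝ) (t : ℝ) (ht : 0 ≤ t) (rest : List (ι → ℝ)) (S : Finset ι)
    (hrest : ∀ c ∈ rest, ∀ i ∈ S, 0 < c i) (ha : ∀ i ∈ S, 0 < a i) (hy : ∀ i ∈ S, 0 < y i) :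
    ∀ r s : ℕ, r + s + 1 + rest.length = S.card →
    mixedPer (a :: (List.replicate r (y + t • a) ++ (List.replicate s y ++ rest))) S *
        mixedPer (y :: (List.replicate (r + s) y ++ rest)) S ≤
      mixedPer (a :: (List.replicate (r + s) y ++ rest)) S *
        mixedPer (y :: (List.replicate r (y + t • a) ++ (List.replicate s y ++ rest))) S
  | 0, s, _ => by simp
  | r + 1, s, h => by
    set z := y + t • a with hz
    have hzpos : ∀ i ∈ S, 0 < z i := fun i hi => by
      have := ha i hi; have := hy i hi
      simp only [hz, Pi.add_apply, Pi.smul_apply, smul_eq_mul]; positivity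
    have ih := mixedPer_ratio a y t ht rest S hrest ha hy r (s + 1) (by omega)
    set X := List.replicate r z ++ (List.replicate s y ++ rest) with hX
    have hXpos : ∀ c ∈ X, ∀ i ∈ S, 0 < c i := by
      intro c hc i hi
      simp only [hX, List.mem_append, List.mem_replicate] at hc
      rcases hc with ⟨_, rfl⟩ | ⟨_, rfl⟩ | hc
      exacts [hzpos i hi, hy i hi, hrest c hc i hi]
    have hXlen : X.length + 2 = S.card := by simp [hX]; omega
    have hp : (List.replicate r z ++ (List.replicate (s + 1) y ++ rest)).Perm (y :: X) := by
      rw [List.replicate_succ, List.cons_append, hX]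
      exact List.perm_middle
    rw [← hz, mixedPer_perm (hp.cons a), mixedPer_perm (hp.cons y),
      show r + (s + 1) = r + 1 + s by omega] at ih
    have h1 := mixedPer_ratio_step a y t ht X S hXlen hXpos hy
    rw [← hz, mixedPer_swap z a, mixedPer_swap z y] at h1
    simp only [List.replicate_succ, List.cons_append]
    rw [← hX]
    have hpos : ∀ c : ι → ℝ, ∀ l : List (ι → ℝ), (∀ i ∈ S, 0 < c i) →
        (∀ d ∈ l, ∀ i ∈ S, 0 < d i) → l.length + 1 ≤ S.card → 0 < mixedPer (c :: l) S := by
      intro c l hc hl hlen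
      refine mixedPer_pos _ _ (fun d hd => ?_) (by simpa using hlen)
      rcases List.mem_cons.mp hd with rfl | hd
      exacts [hc, hl d hd]
    have hyX : 0 < mixedPer (y :: y :: X) S := hpos y _ hy (fun d hd => by
      rcases List.mem_cons.mp hd with rfl | hd
      exacts [hy, hXpos d hd]) (by simp; omega)
    have hyzX : 0 < mixedPer (y :: z :: X) S := hpos y _ hy (fun d hd => by
      rcases List.mem_cons.mp hd with rfl | hd
      exacts [hzpos, hXpos d hd]) (by simp; omega)
    have hc0 : 0 < mixedPer (y :: (List.replicate (r + 1 + s) y ++ rest)) S :=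
      hpos y _ hy (fun d hd => by
        simp only [List.mem_append, List.mem_replicate] at hd
        rcases hd with ⟨_, rfl⟩ | hd
        exacts [hy, hrest d hd]) (by simp; omega)
    set A := mixedPer (a :: z :: X) S
    set B := mixedPer (y :: y :: X) S
    set C := mixedPer (a :: y :: X) S
    set E := mixedPer (y :: z :: X) S
    set c0 := mixedPer (y :: (List.replicate (r + 1 + s) y ++ rest)) S
    set c1 := mixedPer (a :: (List.replicate (r + 1 + s) y ++ rest)) S
    -- `A / E ≤ C / B ≤ c1 / c0`
    have h2 : B * (A * c0) ≤ B * (c1 * E) := by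
      calc B * (A * c0) = (A * B) * c0 := by ring
        _ ≤ (C * E) * c0 := by gcongr
        _ = (C * c0) * E := by ring
        _ ≤ (c1 * B) * E := by gcongr
        _ = B * (c1 * E) := by ring
    exact le_of_mul_le_mul_left h2 hyX

/-- Log-concavity of `t ↦ M(y + t a, …, y + t a, rest)`, in the form of a tangent bound. -/
theorem mixedPer_replicate_le (a y : ι → ℝ) (t : ℝ) (ht : 0 ≤ t) (rest : List (ι → ℝ))
    (S : Finset ι) (k : ℕ) (hS : k + 1 + rest.length = S.card)
    (hrest : ∀ c ∈ rest, ∀ i ∈ S, 0 < c i) (ha : ∀ i ∈ S, 0 < a i) (hy : ∀ i ∈ S, 0 < y i)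
    (c₀ c₁ : ℝ) (h₀ : c₀ = mixedPer (List.replicate (k + 1) y ++ rest) S)
    (h₁ : c₁ = mixedPer (a :: (List.replicate k y ++ rest)) S) :
    mixedPer (List.replicate (k + 1) (y + t • a) ++ rest) S ≤ c₀ * (1 + t * (c₁ / c₀)) ^ (k + 1) := by
  have hc₀ : 0 < c₀ := by
    rw [h₀]
    refine mixedPer_pos _ _ (fun c hc => ?_) (by simp; omega)
    simp only [List.mem_append, List.mem_replicate] at hc
    rcases hc with ⟨_, rfl⟩ | hc
    exacts [hy, hrest c hc]
  have hc₁ : 0 < c₁ := by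
    rw [h₁]
    refine mixedPer_pos _ _ (fun c hc => ?_) (by simp; omega)
    simp only [List.mem_cons, List.mem_append, List.mem_replicate] at hc
    rcases hc with rfl | ⟨_, rfl⟩ | hc
    exacts [ha, hy, hrest c hc]
  -- By the ratio bound, each replacement multiplies the mixed permanent by at most `1 + t c₁ / c₀`.
  have key : ∀ r s : ℕ, r + s = k + 1 →
      mixedPer (List.replicate r (y + t • a) ++ (List.replicate s y ++ rest)) S
        ≤ c₀ * (1 + t * (c₁ / c₀)) ^ r := by
    intro r
    induction r with
    | zero =>
      intro s hs
      obtain rfl : s = k + 1 := by omega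
      simp [h₀]
    | succ r ih =>
      intro s hs
      have h2 := mixedPer_ratio a y t ht rest S hrest ha hy r s (by omega)
      obtain rfl : k = r + s := by omega
      have ih' := ih (s + 1) (by omega)
      have hp : (List.replicate r (y + t • a) ++ (List.replicate (s + 1) y ++ rest)).Perm
          (y :: (List.replicate r (y + t • a) ++ (List.replicate s y ++ rest))) := by
        rw [List.replicate_succ, List.cons_append]
        exact List.perm_middle
      rw [mixedPer_perm hp] at ih'
      rw [List.replicate_succ, List.cons_append] at h₀
      rw [← h₀, ← h₁] at h2
      rw [List.replicate_succ, List.cons_append, mixedPer_add, mixedPer_smul]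
      set A := mixedPer (a :: (List.replicate r (y + t • a) ++ (List.replicate s y ++ rest))) S
      set E := mixedPer (y :: (List.replicate r (y + t • a) ++ (List.replicate s y ++ rest))) S
      have h3 : A ≤ c₁ / c₀ * E := by
        rw [div_mul_eq_mul_div, le_div_iff₀ hc₀]
        exact h2
      calc E + t * A ≤ E + t * (c₁ / c₀ * E) := by gcongr
        _ = E * (1 + t * (c₁ / c₀)) := by ring
        _ ≤ (c₀ * (1 + t * (c₁ / c₀)) ^ r) * (1 + t * (c₁ / c₀)) := by
            gcongr
        _ = _ := by ring
  simpa using key (k + 1) 0 rfl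

end AlexandrovFenchel

/-! ### Capacity and the lower bound for permanents. -/

section Capacity

variable {ι : Type*} [DecidableEq ι]

theorem mixedPer_replicate (y : ι → ℝ) : ∀ (m : ℕ) (S : Finset ι), S.card = m →
    mixedPer (List.replicate m y) S = (m.factorial : ℝ) * ∏ i ∈ S, y i
  | 0, S, h => by simp [Finset.card_eq_zero.mp h, mixedPer]
  | m + 1, S, h => by
    rw [List.replicate_succ, mixedPer_cons]
    have : ∀ i ∈ S, y i * mixedPer (List.replicate m y) (S.erase i)
        = (m.factorial : ℝ) * ∏ i ∈ S, y i := by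
      intro i hi
      rw [mixedPer_replicate y m _ (by rw [Finset.card_erase_of_mem hi, h]; rfl),
        ← Finset.mul_prod_erase S y hi]
      ring
    rw [Finset.sum_congr rfl this, Finset.sum_const, h, Nat.factorial_succ]
    push_cast
    rw [nsmul_eq_mul]
    push_cast
    ring

/-- Replacing one of `k + 1` equal arguments by a further column loses a factor of at most
`e (k + 1)` in the capacity. -/
theorem capacity_step (S : Finset ι) (k : ℕ) (c : Fin (k + 1) → ι → ℝ) (rest : List (ι → ℝ))
    (K : ℝ) (hK : 0 ≤ K) (hS : k + 1 + rest.length = S.card) (hc : ∀ j, ∀ i ∈ S, 0 < c j i)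
    (hrest : ∀ d ∈ rest, ∀ i ∈ S, 0 < d i)
    (h : ∀ w : Fin (k + 1) → ℝ, (∀ j, 0 < w j) →
      K * ∏ j, w j ≤ mixedPer (List.replicate (k + 1) (∑ j, w j • c j) ++ rest) S)
    (w : Fin k → ℝ) (hw : ∀ j, 0 < w j) :
    K / ((k + 1) * Real.exp 1) * ∏ j, w j ≤
      mixedPer (List.replicate k (∑ j, w j • c j.succ) ++ (c 0 :: rest)) S := by
  -- For `k = 0` the vector `y` below is an empty sum, hence not positive, and the tangent bound
  -- does not apply.
  rcases Nat.eq_zero_or_pos k with rfl | hk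
  · have h1 : K ≤ mixedPer (c 0 :: rest) S := by
      simpa [Fin.sum_univ_succ] using h (fun _ => 1) (fun _ => one_pos)
    simp only [Finset.univ_eq_empty, Finset.prod_empty, mul_one, List.replicate_zero,
      List.nil_append]
    refine le_trans (div_le_self hK ?_) h1
    have := Real.add_one_le_exp (1 : ℝ)
    push_cast
    linarith
  set y : ι → ℝ := ∑ j, w j • c j.succ with hy
  have hypos : ∀ i ∈ S, 0 < y i := by
    intro i hi
    simp only [hy, Finset.sum_apply, Pi.smul_apply, smul_eq_mul]
    exact Finset.sum_pos (fun j _ => mul_pos (hw j) (hc _ i hi)) ⟨⟨0, hk⟩, Finset.mem_univ _⟩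
  set c₀ := mixedPer (List.replicate (k + 1) y ++ rest) S with h₀
  set c₁ := mixedPer (c 0 :: (List.replicate k y ++ rest)) S with h₁
  have hc₀ : 0 < c₀ := by
    refine mixedPer_pos _ _ (fun d hd => ?_) (by simp; omega)
    simp only [List.mem_append, List.mem_replicate] at hd
    rcases hd with ⟨_, rfl⟩ | hd
    exacts [hypos, hrest d hd]
  have hc₁ : 0 < c₁ := by
    refine mixedPer_pos _ _ (fun d hd => ?_) (by simp; omega)
    simp only [List.mem_cons, List.mem_append, List.mem_replicate] at hd
    rcases hd with rfl | ⟨_, rfl⟩ | hd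
    exacts [hc 0, hypos, hrest d hd]
  rw [mixedPer_perm (List.perm_middle : (List.replicate k y ++ (c 0 :: rest)).Perm _), ← h₁]
  have hk1 : (0 : ℝ) < (k : ℝ) + 1 := by positivity
  -- This weight for the column `c 0` makes `t c₁ / c₀ = 1/(k + 1)`, so the growth factor is `(1 +
  -- 1/(k+1)) ^ (k+1) ≤ e`.
  set t := c₀ / ((k + 1) * c₁) with ht
  have htpos : 0 < t := by positivity
  have h2 := h (Fin.cons t w) (fun j => by refine Fin.cases ?_ (fun j => ?_) j <;> simp [htpos, hw])
  rw [Fin.prod_univ_succ, Fin.sum_univ_succ] at h2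
  simp only [Fin.cons_zero, Fin.cons_succ] at h2
  rw [← hy, add_comm (t • c 0) y] at h2
  have h3 := h2.trans (mixedPer_replicate_le (c 0) y t htpos.le rest S k hS hrest (hc 0) hypos
    c₀ c₁ h₀ h₁)
  have h4 : t * (c₁ / c₀) = 1 / ((k : ℝ) + 1) := by
    rw [ht]; field_simp
  have h5 : (1 + 1 / ((k : ℝ) + 1)) ^ (k + 1) ≤ Real.exp 1 := by
    calc (1 + 1 / ((k : ℝ) + 1)) ^ (k + 1) ≤ (Real.exp (1 / ((k : ℝ) + 1))) ^ (k + 1) := by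
          gcongr
          rw [add_comm]; exact Real.add_one_le_exp _
      _ = Real.exp 1 := by
          rw [← Real.exp_nat_mul]
          congr 1
          push_cast
          field_simp
  rw [h4] at h3
  have h6 : K * (t * ∏ j, w j) ≤ c₀ * Real.exp 1 := h3.trans (by gcongr)
  have h7 : c₀ * (K * ∏ j, w j) ≤ c₀ * (c₁ * ((k + 1) * Real.exp 1)) := by
    have e : K * (t * ∏ j, w j) = c₀ * (K * ∏ j, w j) / ((k + 1) * c₁) := by rw [ht]; ring
    rw [e, div_le_iff₀ (by positivity)] at h6
    linarith
  have h8 := le_of_mul_le_mul_left h7 hc₀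
  rw [div_mul_eq_mul_div, div_le_iff₀ (by positivity)]
  exact h8

/-- Iterating `capacity_step` until no weights remain, the losses `e (k + 1)` multiply to `k! e ^
k`. -/
theorem le_mixedPer_of_capacity (S : Finset ι) : ∀ (k : ℕ) (c : Fin k → ι → ℝ)
    (rest : List (ι → ℝ)) (K : ℝ), 0 ≤ K → k + rest.length = S.card →
    (∀ j, ∀ i ∈ S, 0 < c j i) → (∀ d ∈ rest, ∀ i ∈ S, 0 < d i) →
    (∀ w : Fin k → ℝ, (∀ j, 0 < w j) →
      K * ∏ j, w j ≤ mixedPer (List.replicate k (∑ j, w j • c j) ++ rest) S) →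
    K ≤ (k.factorial : ℝ) * Real.exp 1 ^ k * mixedPer (List.ofFn c ++ rest) S
  | 0, c, rest, K, _, _, _, _, h => by
    simpa using h (fun _ => 1) (fun _ => one_pos)
  | k + 1, c, rest, K, hK, hS, hc, hrest, h => by
    have h1 := le_mixedPer_of_capacity S k (fun j => c j.succ) (c 0 :: rest)
      (K / ((k + 1) * Real.exp 1)) (by positivity) (by simp; omega) (fun j => hc _)
      (fun d hd => by
        rcases List.mem_cons.mp hd with rfl | hd
        exacts [hc 0, hrest d hd])
      (capacity_step S k c rest K hK hS hc hrest h)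
    rw [mixedPer_perm (List.perm_middle :
      (List.ofFn (fun j : Fin k => c j.succ) ++ (c 0 :: rest)).Perm _),
      div_le_iff₀ (by positivity)] at h1
    rw [List.ofFn_succ, Nat.factorial_succ]
    push_cast
    rw [pow_succ]
    simp only [List.cons_append]
    linarith

/-- The permanent of a positive doubly stochastic matrix of order `n` is at least `e⁻ⁿ`. -/
theorem one_le_exp_mul_mixedPer (n : ℕ) (a : Fin n → Fin n → ℝ) (hpos : ∀ j i, 0 < a j i)
    (hcol : ∀ j, ∑ i, a j i = 1) (hrow : ∀ i, ∑ j, a j i = 1) :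
    1 ≤ Real.exp 1 ^ n * mixedPer (List.ofFn a) Finset.univ := by
  have h := le_mixedPer_of_capacity Finset.univ n a [] (n.factorial : ℝ) (by positivity)
    (by simp) (fun j i _ => hpos j i) (by simp) (fun w hw => by
      rw [List.append_nil, mixedPer_replicate _ n _ (by simp)]
      refine mul_le_mul_of_nonneg_left ?_ (by positivity)
      -- Weighted AM–GM, whose weights sum to `1` by `hrow`. Multiplied over `i`, the exponents of
      -- each `w j` add up to `1` by `hcol`, so `n!` is a lower bound for the capacity.
      have h1 : ∀ i, ∏ j, w j ^ a j i ≤ (∑ j, w j • a j) i := by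
        intro i
        have := Real.geom_mean_le_arith_mean_weighted Finset.univ (fun j => a j i) w
          (fun j _ => (hpos j i).le) (hrow i) (fun j _ => (hw j).le)
        simpa [Finset.sum_apply, mul_comm] using this
      calc ∏ j, w j = ∏ j, ∏ i, w j ^ a j i := by
            refine Finset.prod_congr rfl fun j _ => ?_
            rw [← Real.rpow_sum_of_pos (hw j), hcol, Real.rpow_one]
        _ = ∏ i, ∏ j, w j ^ a j i := Finset.prod_comm
        _ ≤ ∏ i, (∑ j, w j • a j) i :=
            Finset.prod_le_prod (fun i _ => Finset.prod_nonneg fun j _ =>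
              Real.rpow_nonneg (hw j).le _) (fun i _ => h1 i))
  rw [List.append_nil, mul_assoc] at h
  have hf : (0 : ℝ) < n.factorial := by positivity
  nlinarith

theorem mixedPer_ofFn : ∀ (m : ℕ) (a : Fin m → ι → ℝ) (S : Finset ι) [Fintype ι],
    mixedPer (List.ofFn a) S = ∑ f : Fin m → ι,
      if Function.Injective f ∧ ∀ j, f j ∈ S then ∏ j, a j (f j) else 0
  | 0, a, S, _ => by
    simp [mixedPer, Function.injective_of_subsingleton]
  | m + 1, a, S, _ => by
    rw [List.ofFn_succ, mixedPer_cons, ← (Fin.consEquiv (fun _ : Fin (m + 1) => ι)).sum_comp,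
      Fintype.sum_prod_type, ← Finset.sum_subset (Finset.subset_univ S)]
    · refine Finset.sum_congr rfl fun i hi => ?_
      rw [mixedPer_ofFn m, Finset.mul_sum]
      refine Finset.sum_congr rfl fun g _ => ?_
      have e : Fin.consEquiv (fun _ : Fin (m + 1) => ι) (i, g) = Fin.cons i g := rfl
      simp only [e, Fin.cons_injective_iff]
      simp only [Fin.forall_fin_succ, Fin.cons_zero,
        Fin.cons_succ, Fin.prod_univ_succ, Finset.mem_erase, mul_ite, mul_zero, Set.mem_range,
        not_exists, hi, true_and]
      congr 1
      apply propext
      constructor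
      · rintro ⟨h1, h2⟩
        exact ⟨⟨fun j => (h2 j).1, h1⟩, fun j => (h2 j).2⟩
      · rintro ⟨⟨h1, h2⟩, h3⟩
        exact ⟨h2, fun j => ⟨h1 j, h3 j⟩⟩
    · intro i _ hi
      refine Finset.sum_eq_zero fun g _ => if_neg fun h => hi ?_
      simpa using h.2 0

end Capacity

/-! ### Counting matchings in regular bipartite graphs. -/

/-- A bipartite graph on `Fin n` and `Fin n` that is `k`-regular on both sides. -/
def IsBiregular {n : ℕ} (R : Fin n → Fin n → Prop) [∀ i j, Decidable (R i j)] (k : ℕ) : Prop :=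
  (∀ i, (Finset.univ.filter fun j => R i j).card = k) ∧
    ∀ j, (Finset.univ.filter fun i => R i j).card = k

/-- A `k`-regular bipartite graph of order `n + n` has at least `(k / e)ⁿ` perfect matchings. -/
theorem le_card_matchings {n : ℕ} (R : Fin n → Fin n → Prop) [∀ i j, Decidable (R i j)] {k : ℕ}
    (hR : IsBiregular R k) :
    ((k : ℝ) / Real.exp 1) ^ n ≤
      ((Finset.univ.filter fun σ : Equiv.Perm (Fin n) => ∀ j, R j (σ j)).card : ℝ) := by
  -- The permanent bound needs positive entries, so zeros become `ε`. All line sums are then a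
  -- common `s ≥ k`; after dividing by it, `ε` tends to `0`.
  set a : ℝ → Fin n → Fin n → ℝ := fun ε j i => if R j i then 1 else ε with ha
  set F : ℝ → ℝ := fun ε => ∑ f : Fin n → Fin n,
    if Function.Injective f then ∏ j, a ε j (f j) else 0 with hF
  have hcont : Continuous F := by
    refine continuous_finsetSum _ fun f _ => ?_
    split_ifs
    · refine continuous_finsetProd _ fun j _ => ?_
      simp only [ha]
      split_ifs <;> fun_prop
    · exact continuous_const
  have hF0 : F 0 ≤ ((Finset.univ.filter fun σ : Equiv.Perm (Fin n) => ∀ j, R j (σ j)).card : ℝ) := by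
    have h1 : F 0 = ((Finset.univ.filter fun f : Fin n → Fin n =>
        Function.Injective f ∧ ∀ j, R j (f j)).card : ℝ) := by
      rw [Finset.card_filter]
      push_cast
      refine Finset.sum_congr rfl fun f _ => ?_
      by_cases hf : Function.Injective f
      · simp only [hf, if_true, true_and, ha, Finset.prod_ite_zero, Finset.mem_univ,
          true_imp_iff, Finset.prod_const_one]
      · simp [hf]
    rw [h1]
    norm_cast
    refine Finset.card_le_card_of_surjOn (fun σ => ⇑σ) ?_
    intro f hf
    simp only [Finset.coe_filter, Finset.mem_univ, true_and, Set.mem_ofPred_eq] at hf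
    refine ⟨Equiv.ofBijective f (Finite.injective_iff_bijective.mp hf.1), ?_, rfl⟩
    simpa using hf.2
  have hpos : ∀ ε : ℝ, 0 < ε → ((k : ℝ) / Real.exp 1) ^ n ≤ F ε := by
    intro ε hε
    rcases Nat.eq_zero_or_pos n with rfl | hn
    · simp [hF, Function.injective_of_subsingleton]
    have hkn : k ≤ n := by
      rw [← hR.1 ⟨0, hn⟩]
      exact (Finset.card_le_univ _).trans (by simp)
    set s : ℝ := k + ε * (n - k) with hs
    have hkn' : (k : ℝ) ≤ n := by exact_mod_cast hkn
    have hsk : (k : ℝ) ≤ s := by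
      have : 0 ≤ ε * ((n : ℝ) - k) := mul_nonneg hε.le (by linarith)
      linarith
    have hs0 : 0 < s := by
      rcases Nat.eq_zero_or_pos k with rfl | hk
      · simp only [hs]; push_cast; simp; positivity
      · have : (0 : ℝ) < k := by exact_mod_cast hk
        linarith
    have hsum : ∀ p : Fin n → Prop, ∀ [DecidablePred p], (Finset.univ.filter p).card = k →
        ∑ i, (if p i then (1 : ℝ) else ε) = s := by
      intro p _ hp
      rw [Finset.sum_ite, Finset.sum_const, Finset.sum_const, Finset.filter_not,
        Finset.card_sdiff_of_subset (Finset.filter_subset _ _), hp, Finset.card_univ,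
        Fintype.card_fin, nsmul_eq_mul, nsmul_eq_mul, Nat.cast_sub hkn]
      ring
    have h := one_le_exp_mul_mixedPer n (fun j i => a ε j i / s)
      (fun j i => div_pos (by simp only [ha]; split_ifs <;> linarith) hs0)
      (fun j => by rw [← Finset.sum_div, hsum _ (hR.1 j), div_self hs0.ne'])
      (fun i => by rw [← Finset.sum_div, hsum _ (hR.2 i), div_self hs0.ne'])
    rw [mixedPer_ofFn] at h
    have e : (∑ f : Fin n → Fin n, if Function.Injective f ∧ ∀ j, f j ∈ (Finset.univ : Finset (Fin n))
        then ∏ j, a ε j (f j) / s else 0) = F ε / s ^ n := by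
      rw [hF, Finset.sum_div]
      refine Finset.sum_congr rfl fun f _ => ?_
      simp only [Finset.mem_univ, implies_true, and_true, Finset.prod_div_distrib,
        Finset.prod_const, Finset.card_univ, Fintype.card_fin]
      split_ifs <;> simp
    rw [e, mul_div_assoc', le_div_iff₀ (by positivity), one_mul] at h
    rw [div_pow, div_le_iff₀ (by positivity)]
    calc (k : ℝ) ^ n ≤ s ^ n := by gcongr
      _ ≤ _ := by linarith
  refine le_trans ?_ hF0
  refine ge_of_tendsto (hcont.continuousWithinAt (s := Set.Ioi 0) (x := 0)) ?_
  filter_upwards [self_mem_nhdsWithin] with ε hε using hpos ε hε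

/-! ### Rigid fillings and half-sums of permutations. -/

/-- A family of nonnegative doubly stochastic matrices with sum `D` that admits no nonzero
perturbation supported on its support with all line sums zero. -/
structure IsRigidFilling {n L : ℕ} (D : Fin n → Fin n → ℝ) (l : Fin L → Fin n → Fin n → ℝ) :
    Prop where
  nonneg : ∀ i j k, 0 ≤ l i j k
  row : ∀ i j, ∑ k, l i j k = 1
  col : ∀ i k, ∑ j, l i j k = 1
  sum : ∀ j k, ∑ i, l i j k = D j k
  rigid : ∀ f : Fin L → Fin n → Fin n → ℝ, (∀ i j k, l i j k = 0 → f i j k = 0) →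
    (∀ i j, ∑ k, f i j k = 0) → (∀ i k, ∑ j, f i j k = 0) → (∀ j k, ∑ i, f i j k = 0) →
    ∀ i j k, f i j k = 0

theorem IsRigidFilling.eq_zero_of_nonpos {n L : ℕ} {D : Fin n → Fin n → ℝ}
    {l : Fin L → Fin n → Fin n → ℝ} (h : IsRigidFilling D l) {j k : Fin n} (hD : D j k ≤ 0)
    (i : Fin L) : l i j k = 0 := by
  have h0 : ∑ i, l i j k = 0 :=
    le_antisymm ((h.sum j k).trans_le hD) (Finset.sum_nonneg fun i _ => h.nonneg i j k)
  exact (Finset.sum_eq_zero_iff_of_nonneg fun i _ => h.nonneg i j k).mp h0 i (Finset.mem_univ i)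

/-- Half the sum of two permutation matrices. -/
noncomputable def halfSum {n : ℕ} (P Q : Equiv.Perm (Fin n)) : Fin n → Fin n → ℝ :=
  fun j k => (if P j = k then 1 / 2 else 0) + (if Q j = k then 1 / 2 else 0)

section HalfSum

variable {n : ℕ} (P Q : Equiv.Perm (Fin n))

theorem halfSum_nonneg (j k : Fin n) : 0 ≤ halfSum P Q j k := by
  unfold halfSum; split_ifs <;> norm_num

theorem halfSum_row (j : Fin n) : ∑ k, halfSum P Q j k = 1 := by
  simp only [halfSum, Finset.sum_add_distrib, Finset.sum_ite_eq, Finset.mem_univ, if_true]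
  norm_num

theorem halfSum_col (k : Fin n) : ∑ j, halfSum P Q j k = 1 := by
  simp only [halfSum, Finset.sum_add_distrib, ← Equiv.eq_symm_apply, Finset.sum_ite_eq',
    Finset.mem_univ, if_true]
  norm_num

theorem halfSum_eq_zero {j k : Fin n} (hP : P j ≠ k) (hQ : Q j ≠ k) : halfSum P Q j k = 0 := by
  simp [halfSum, hP, hQ]

theorem half_le_halfSum_left (j : Fin n) : 1 / 2 ≤ halfSum P Q j (P j) := by
  unfold halfSum; split_ifs <;> norm_num at *

theorem half_le_halfSum_right (j : Fin n) : 1 / 2 ≤ halfSum P Q j (Q j) := by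
  unfold halfSum; split_ifs <;> norm_num at *

variable {P Q}

/-- The row equation of a perturbation supported on `halfSum P Q`. -/
theorem add_eq_zero_of_row {f : Fin n → Fin n → ℝ}
    (hf : ∀ j k, halfSum P Q j k = 0 → f j k = 0) (hrow : ∀ j, ∑ k, f j k = 0)
    {j : Fin n} (hPQ : P j ≠ Q j) : f j (P j) + f j (Q j) = 0 := by
  rw [← hrow j, ← Finset.sum_pair hPQ]
  refine Finset.sum_subset (Finset.subset_univ _) fun k _ hk => hf j k ?_
  simp only [Finset.mem_insert, Finset.mem_singleton, not_or] at hk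
  exact halfSum_eq_zero P Q (Ne.symm hk.1) (Ne.symm hk.2)

/-- The column equation of a perturbation supported on `halfSum P Q`. -/
theorem add_eq_zero_of_col {f : Fin n → Fin n → ℝ}
    (hf : ∀ j k, halfSum P Q j k = 0 → f j k = 0) (hcol : ∀ k, ∑ j, f j k = 0)
    {i j k : Fin n} (hij : i ≠ j) (hP : P i = k) (hQ : Q j = k) : f i k + f j k = 0 := by
  rw [← hcol k, ← Finset.sum_pair (f := fun m => f m k) hij]
  refine Finset.sum_subset (Finset.subset_univ _) fun m _ hm => hf m k ?_
  simp only [Finset.mem_insert, Finset.mem_singleton, not_or] at hm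
  refine halfSum_eq_zero P Q (fun h => hm.1 (P.injective (h.trans hP.symm)))
    (fun h => hm.2 (Q.injective (h.trans hQ.symm)))

end HalfSum

/-- The new plane uses up the demand `1/2` along `P`, so later planes vanish there and the vertical
equation kills the perturbation on `P`. Each row of the plane has one other support entry, at `Q`,
where the row equation kills it as well. The remaining planes form a rigid filling by hypothesis. -/
theorem IsRigidFilling.cons {n L : ℕ} {D : Fin n → Fin n → ℝ} {l : Fin L → Fin n → Fin n → ℝ}
    {P Q : Equiv.Perm (Fin n)} (hPQ : ∀ j, P j ≠ Q j) (hP : ∀ j, D j (P j) = 1 / 2)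
    (hl : IsRigidFilling (fun j k => D j k - halfSum P Q j k) l) :
    IsRigidFilling D (Fin.cons (halfSum P Q) l : Fin (L + 1) → Fin n → Fin n → ℝ) where
  nonneg i := by
    refine Fin.cases ?_ (fun i => ?_) i
    · simpa using halfSum_nonneg P Q
    · simpa using hl.nonneg i
  row i := by
    refine Fin.cases ?_ (fun i => ?_) i
    · simpa using halfSum_row P Q
    · simpa using hl.row i
  col i := by
    refine Fin.cases ?_ (fun i => ?_) i
    · simpa using halfSum_col P Q
    · simpa using hl.col i
  sum j k := by
    rw [Fin.sum_univ_succ]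
    simp [hl.sum]
  rigid f hf hrow hcol hsum := by
    have hf0 : ∀ j k, halfSum P Q j k = 0 → f 0 j k = 0 := fun j k h => hf 0 j k (by simpa using h)
    have hfs : ∀ i j k, l i j k = 0 → f i.succ j k = 0 :=
      fun i j k h => hf i.succ j k (by simpa using h)
    have hP0 : ∀ j, f 0 j (P j) = 0 := by
      intro j
      have h := hsum j (P j)
      rw [Fin.sum_univ_succ, Finset.sum_eq_zero fun i _ => hfs i j (P j)
        (hl.eq_zero_of_nonpos (by
          have := half_le_halfSum_left P Q j
          rw [hP]; linarith) i), add_zero] at h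
      exact h
    have h0 : ∀ j k, f 0 j k = 0 := by
      intro j k
      by_cases h1 : P j = k
      · rw [← h1, hP0]
      by_cases h2 : Q j = k
      · have := add_eq_zero_of_row hf0 (hrow 0) (hPQ j)
        rw [hP0, zero_add] at this
        rw [← h2, this]
      · exact hf0 j k (halfSum_eq_zero P Q h1 h2)
    have hs := hl.rigid (fun i => f i.succ) hfs (fun i => hrow _) (fun i => hcol _) (fun j k => by
      have := hsum j k
      rwa [Fin.sum_univ_succ, h0, zero_add] at this)
    intro i
    refine Fin.cases h0 hs i

/-! ### Half-regular matrices and the layer-by-layer choice. -/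

/-- A matrix with entries `0`, `1/2`, `1`, with `d` entries `1` and `h` entries `1/2` in every row
and column. -/
structure IsHalfRegular {n : ℕ} (D : Fin n → Fin n → ℝ) (h d : ℕ) : Prop where
  values : ∀ j k, D j k = 0 ∨ D j k = 1 / 2 ∨ D j k = 1
  rowCard : ∀ j, (Finset.univ.filter fun k => D j k = 1).card = d
  colCard : ∀ k, (Finset.univ.filter fun j => D j k = 1).card = d
  rowSum : ∀ j, ∑ k, D j k = d + h / 2
  colSum : ∀ k, ∑ j, D j k = d + h / 2

/-- `IsHalfRegular` records line sums because they subtract linearly when a plane is removed; the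
number of halves is recovered here. -/
theorem card_half_of_sum {n : ℕ} {x : Fin n → ℝ} {h d : ℕ}
    (hx : ∀ k, x k = 0 ∨ x k = 1 / 2 ∨ x k = 1)
    (hd : (Finset.univ.filter fun k => x k = 1).card = d) (hs : ∑ k, x k = d + h / 2) :
    (Finset.univ.filter fun k => x k = 1 / 2).card = h := by
  have e : ∀ k, x k = (if x k = 1 then 1 else 0) + (1 / 2) * (if x k = 1 / 2 then 1 else 0) := by
    intro k
    rcases hx k with h | h | h <;> rw [h] <;> norm_num
  have e2 : ∑ k, x k = ∑ k, ((if x k = 1 then 1 else 0) + (1 / 2) * (if x k = 1 / 2 then 1 else 0)) :=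
    Finset.sum_congr rfl fun k _ => e k
  rw [Finset.sum_add_distrib, ← Finset.mul_sum, Finset.sum_boole, Finset.sum_boole, hd, hs] at e2
  have : ((Finset.univ.filter fun k => x k = 1 / 2).card : ℝ) = h := by linarith
  exact_mod_cast this

section HalfRegular

variable {n : ℕ} {D : Fin n → Fin n → ℝ} {h d : ℕ}

theorem IsHalfRegular.one (hD : IsHalfRegular D h d) : IsBiregular (fun j k => D j k = 1) d :=
  ⟨hD.rowCard, hD.colCard⟩

theorem IsHalfRegular.half (hD : IsHalfRegular D h d) :
    IsBiregular (fun j k => D j k = 1 / 2) h :=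
  ⟨fun j => card_half_of_sum (hD.values j) (hD.rowCard j) (hD.rowSum j),
    fun k => card_half_of_sum (fun j => hD.values j k) (hD.colCard k) (hD.colSum k)⟩

/-- The lower bound `((k+1)/e) ^ n` is positive, which stands in for Hall's theorem. -/
theorem IsBiregular.exists_matching {R : Fin n → Fin n → Prop} [∀ i j, Decidable (R i j)] {k : ℕ}
    (hR : IsBiregular R (k + 1)) : ∃ σ : Equiv.Perm (Fin n), ∀ j, R j (σ j) := by
  have h1 := le_card_matchings R hR
  have h2 : (0 : ℝ) < (((k + 1 : ℕ) : ℝ) / Real.exp 1) ^ n := by positivity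
  have h3 := h2.trans_le h1
  norm_cast at h3
  obtain ⟨σ, hσ⟩ := Finset.card_pos.mp h3
  exact ⟨σ, by simpa using hσ⟩

theorem IsBiregular.remove_matching {R : Fin n → Fin n → Prop} [∀ i j, Decidable (R i j)] {k : ℕ}
    (hR : IsBiregular R (k + 1)) {σ : Equiv.Perm (Fin n)} (hσ : ∀ j, R j (σ j)) :
    IsBiregular (fun i j => R i j ∧ σ i ≠ j) k := by
  constructor
  · intro i
    have e : (Finset.univ.filter fun j => R i j ∧ σ i ≠ j)
        = (Finset.univ.filter fun j => R i j).erase (σ i) := by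
      ext j; simp only [Finset.mem_filter, Finset.mem_univ, true_and, Finset.mem_erase]
      rw [and_comm, ne_comm]
    rw [e, Finset.card_erase_of_mem (by simpa using hσ i), hR.1]; rfl
  · intro j
    have e : (Finset.univ.filter fun i => R i j ∧ σ i ≠ j)
        = (Finset.univ.filter fun i => R i j).erase (σ.symm j) := by
      ext i; simp only [Finset.mem_filter, Finset.mem_univ, true_and, Finset.mem_erase]
      rw [and_comm, Ne, Ne, Equiv.eq_symm_apply]
    rw [e, Finset.card_erase_of_mem (by simpa using hσ (σ.symm j)), hR.2]; rfl

/-- Removing half a matching of halves and half a matching of ones. -/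
theorem IsHalfRegular.sub_generic (hD : IsHalfRegular D h (d + 1)) {P Q : Equiv.Perm (Fin n)}
    (hP : ∀ j, D j (P j) = 1 / 2) (hQ : ∀ j, D j (Q j) = 1) :
    IsHalfRegular (fun j k => D j k - halfSum P Q j k) h d := by
  -- Halves along `P` become zeros and ones along `Q` become halves, so each line keeps `h` halves
  -- and loses a single one.
  have hone : ∀ j k, D j k - halfSum P Q j k = 1 ↔ D j k = 1 ∧ Q j ≠ k := by
    intro j k
    unfold halfSum
    by_cases h1 : P j = k
    · have := hP j
      have hq : Q j ≠ k := fun h2 => by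
        have := hQ j; rw [h2, ← h1] at this; linarith
      rw [h1] at this
      simp only [h1, if_true, hq, if_false, this]; norm_num
    · by_cases h2 : Q j = k
      · have := hQ j
        rw [h2] at this
        simp only [h1, if_false, h2, if_true, this]; norm_num
      · simp [h1, h2]
  have hreg := hD.one.remove_matching hQ
  refine ⟨fun j k => ?_, fun j => ?_, fun k => ?_, fun j => ?_, fun k => ?_⟩
  · unfold halfSum
    by_cases h1 : P j = k
    · have := hP j
      have hq : Q j ≠ k := fun h2 => by
        have := hQ j; rw [h2, ← h1] at this; linarith
      rw [h1] at this
      simp only [h1, if_true, hq, if_false, this]; norm_num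
    · by_cases h2 : Q j = k
      · have := hQ j
        rw [h2] at this
        simp only [h1, if_false, h2, if_true, this]; norm_num
      · simpa [h1, h2] using hD.values j k
  · simpa only [hone] using hreg.1 j
  · simpa only [hone] using hreg.2 k
  · rw [Finset.sum_sub_distrib, hD.rowSum, halfSum_row]; push_cast; ring
  · rw [Finset.sum_sub_distrib, hD.colSum, halfSum_col]; push_cast; ring

/-- Removing half the sum of two disjoint matchings of halves. -/
theorem IsHalfRegular.sub_final (hD : IsHalfRegular D (h + 2) 0) {P Q : Equiv.Perm (Fin n)}
    (hPQ : ∀ j, P j ≠ Q j) (hP : ∀ j, D j (P j) = 1 / 2) (hQ : ∀ j, D j (Q j) = 1 / 2) :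
    IsHalfRegular (fun j k => D j k - halfSum P Q j k) h 0 := by
  have hne : ∀ j k, D j k ≠ 1 := by
    intro j k h1
    have := hD.rowCard j
    rw [Finset.card_eq_zero, Finset.filter_eq_empty_iff] at this
    exact this (Finset.mem_univ k) h1
  have hval : ∀ j k, D j k - halfSum P Q j k = 0 ∨ D j k - halfSum P Q j k = 1 / 2 := by
    intro j k
    unfold halfSum
    by_cases h1 : P j = k
    · have := hP j
      have hq : Q j ≠ k := fun h2 => hPQ j (h1.trans h2.symm)
      rw [h1] at this
      simp only [h1, if_true, hq, if_false, this]; norm_num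
    · by_cases h2 : Q j = k
      · have := hQ j
        rw [h2] at this
        simp only [h1, if_false, h2, if_true, this]; norm_num
      · rcases hD.values j k with h | h | h
        · simp [h1, h2, h]
        · simp [h1, h2, h]
        · exact absurd h (hne j k)
  have hval1 : ∀ j k, ¬ D j k - halfSum P Q j k = 1 := by
    intro j k h1
    rcases hval j k with h | h <;> rw [h1] at h <;> norm_num at h
  refine ⟨fun j k => ?_, fun j => ?_, fun k => ?_, fun j => ?_, fun k => ?_⟩
  · rcases hval j k with h | h
    exacts [Or.inl h, Or.inr (Or.inl h)]
  · simp only [hval1, Finset.filter_false, Finset.card_empty]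
  · simp only [hval1, Finset.filter_false, Finset.card_empty]
  · rw [Finset.sum_sub_distrib, hD.rowSum, halfSum_row]; push_cast; ring
  · rw [Finset.sum_sub_distrib, hD.colSum, halfSum_col]; push_cast; ring

end HalfRegular

/-- When no ones are left, the halves split into disjoint matchings taken in pairs. These planes
need only exist: they contribute nothing to the count. -/
theorem exists_filling_of_halves {n : ℕ} : ∀ (g : ℕ) (D : Fin n → Fin n → ℝ),
    IsHalfRegular D (2 * g) 0 → ∃ l : Fin g → Fin n → Fin n → ℝ, IsRigidFilling D l
  | 0, D, hD => by
    refine ⟨fun i => i.elim0, fun i => i.elim0, fun i => i.elim0, fun i => i.elim0,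
      fun j k => ?_, fun f _ _ _ _ i => i.elim0⟩
    rw [Finset.univ_eq_empty, Finset.sum_empty]
    have h0 : ∑ k, D j k = 0 := by rw [hD.rowSum]; simp
    have hn : ∀ k ∈ Finset.univ, 0 ≤ D j k := fun k _ => by
      rcases hD.values j k with h | h | h <;> rw [h] <;> norm_num
    exact ((Finset.sum_eq_zero_iff_of_nonneg hn).mp h0 k (Finset.mem_univ k)).symm
  | g + 1, D, hD => by
    obtain ⟨P, hP⟩ := hD.half.exists_matching
    obtain ⟨Q, hQ⟩ := (hD.half.remove_matching hP).exists_matching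
    obtain ⟨l, hl⟩ := exists_filling_of_halves g _
      (hD.sub_final (fun j => (hQ j).2) hP fun j => (hQ j).1)
    exact ⟨_, hl.cons (fun j => (hQ j).2) hP⟩

/-- `D` tells the two permutations apart: `P` lies on its halves and `Q` on its ones, so the plane
reveals both. -/
theorem halfSum_injective {n : ℕ} {D : Fin n → Fin n → ℝ} {P Q P' Q' : Equiv.Perm (Fin n)}
    (hP : ∀ j, D j (P j) = 1 / 2) (hQ : ∀ j, D j (Q j) = 1)
    (hP' : ∀ j, D j (P' j) = 1 / 2) (hQ' : ∀ j, D j (Q' j) = 1)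
    (h : halfSum P Q = halfSum P' Q') : P = P' ∧ Q = Q' := by
  constructor
  · ext1 j
    by_contra hne
    have h1 := half_le_halfSum_left P Q j
    rw [h, halfSum_eq_zero P' Q' (Ne.symm hne) (fun h2 => by
      have := hQ' j; rw [h2, hP] at this; norm_num at this)] at h1
    norm_num at h1
  · ext1 j
    by_contra hne
    have h1 := half_le_halfSum_right P Q j
    rw [h, halfSum_eq_zero P' Q' (fun h2 => by
      have := hP' j; rw [h2, hQ] at this; norm_num at this) (Ne.symm hne)] at h1
    norm_num at h1

/-- The number of rigid fillings of a matrix with `2 * g` halves and `d` ones in every line. -/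
theorem exists_many_fillings {n : ℕ} (g : ℕ) : ∀ (d : ℕ) (L : ℕ), L = d + g →
    ∀ D : Fin n → Fin n → ℝ, IsHalfRegular D (2 * g) d →
    ∃ s : Finset (Fin L → Fin n → Fin n → ℝ), (∀ l ∈ s, IsRigidFilling D l) ∧
      ∏ i ∈ Finset.range d, ((((2 * g : ℕ) : ℝ) / Real.exp 1) ^ n *
        (((i + 1 : ℕ) : ℝ) / Real.exp 1) ^ n) ≤ (s.card : ℝ)
  | 0, L, hL, D, hD => by
    obtain rfl : L = g := by omega
    obtain ⟨l, hl⟩ := exists_filling_of_halves L D hD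
    exact ⟨{l}, by simpa using hl, by simp⟩
  | d + 1, L, hL, D, hD => by
    classical
    obtain ⟨L, rfl⟩ : ∃ M, L = M + 1 := ⟨d + g, by omega⟩
    set A := Finset.univ.filter fun σ : Equiv.Perm (Fin n) => ∀ j, D j (σ j) = 1 / 2 with hA
    set B := Finset.univ.filter fun σ : Equiv.Perm (Fin n) => ∀ j, D j (σ j) = 1 with hB
    have hAm : ∀ {P}, P ∈ A → ∀ j, D j (P j) = 1 / 2 := fun h => by simpa [hA] using h
    have hBm : ∀ {Q}, Q ∈ B → ∀ j, D j (Q j) = 1 := fun h => by simpa [hB] using h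
    have ih : ∀ x : Equiv.Perm (Fin n) × Equiv.Perm (Fin n),
        ∃ s : Finset (Fin L → Fin n → Fin n → ℝ), x ∈ A ×ˢ B →
        (∀ l ∈ s, IsRigidFilling (fun j k => D j k - halfSum x.1 x.2 j k) l) ∧
          ∏ i ∈ Finset.range d, ((((2 * g : ℕ) : ℝ) / Real.exp 1) ^ n *
            (((i + 1 : ℕ) : ℝ) / Real.exp 1) ^ n) ≤ (s.card : ℝ) := by
      intro x
      by_cases hx : x ∈ A ×ˢ B
      · rw [Finset.mem_product] at hx
        obtain ⟨s, hs⟩ := exists_many_fillings g d L (by omega) _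
          (hD.sub_generic (hAm hx.1) (hBm hx.2))
        exact ⟨s, fun _ => hs⟩
      · exact ⟨∅, fun h => absurd h hx⟩
    choose s hs using ih
    have hinj : ∀ M : Fin n → Fin n → ℝ, Function.Injective
        (fun l : Fin L → Fin n → Fin n → ℝ => (Fin.cons M l : Fin (L + 1) → Fin n → Fin n → ℝ)) :=
      fun M => Fin.cons_right_injective (α := fun _ => Fin n → Fin n → ℝ) M
    refine ⟨(A ×ˢ B).biUnion fun x => (s x).image fun l => Fin.cons (halfSum x.1 x.2) l, ?_, ?_⟩
    · intro l hl
      simp only [Finset.mem_biUnion, Finset.mem_image] at hl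
      obtain ⟨x, hx, l', hl', rfl⟩ := hl
      have hx' := Finset.mem_product.mp hx
      refine ((hs x hx).1 l' hl').cons (fun j h => ?_) (hAm hx'.1)
      have h1 := hAm hx'.1 j
      rw [h, hBm hx'.2] at h1
      norm_num at h1
    -- The first plane determines `(P, Q)`, so different pairs give disjoint families and the number
    -- of choices multiplies.
    · rw [Finset.card_biUnion]
      · simp only [Finset.card_image_of_injective _ (hinj _)]
        rw [Finset.prod_range_succ]
        push_cast
        have h1 : ∀ x ∈ A ×ˢ B, ∏ i ∈ Finset.range d, ((((2 * g : ℕ) : ℝ) / Real.exp 1) ^ n *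
            (((i + 1 : ℕ) : ℝ) / Real.exp 1) ^ n) ≤ ((s x).card : ℝ) := fun x hx => (hs x hx).2
        have h2 := Finset.sum_le_sum h1
        rw [Finset.sum_const, Finset.card_product, nsmul_eq_mul] at h2
        push_cast at h2
        refine le_trans ?_ h2
        rw [mul_comm]
        have h3 := le_card_matchings _ hD.half
        have h4 := le_card_matchings _ hD.one
        push_cast at h3 h4
        gcongr
      · intro x hx y hy hxy
        rw [Function.onFun, Finset.disjoint_left]
        intro l hl hl'
        simp only [Finset.mem_image] at hl hl'
        obtain ⟨a, _, rfl⟩ := hl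
        obtain ⟨b, _, hb⟩ := hl'
        have h0 := congrFun hb 0
        simp only [Fin.cons_zero] at h0
        have hx' := Finset.mem_product.mp hx
        have hy' := Finset.mem_product.mp hy
        have := halfSum_injective (hAm hy'.1) (hBm hy'.2) (hAm hx'.1) (hBm hx'.2) h0
        exact hxy (Prod.ext this.1.symm this.2.symm)

/-! ### Hub groups, the rigid source of the initial halves. -/

section Hub

variable {n : ℕ} [NeZero n]

/-- The circulant matrix of half the shifts by `c` and `c'`. -/
noncomputable def circulantPlane (c c' : Fin n) : Fin n → Fin n → ℝ :=
  halfSum (Equiv.addRight c) (Equiv.addRight c')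

/-- The shift by `c`, preceded by the transposition of `0` and `1`. -/
def twistedShift (c : Fin n) : Equiv.Perm (Fin n) :=
  (Equiv.swap 0 1).trans (Equiv.addRight c)

/-- Half the sum of the twisted shift by `c` and the shift by `c'`. -/
noncomputable def twistedPlane (c c' : Fin n) : Fin n → Fin n → ℝ :=
  halfSum (twistedShift c) (Equiv.addRight c')

theorem twistedShift_zero (c : Fin n) : twistedShift c 0 = 1 + c := by
  simp [twistedShift]

theorem twistedShift_one (c : Fin n) : twistedShift c 1 = 0 + c := by
  simp [twistedShift]

theorem twistedShift_of_ne (c : Fin n) {j : Fin n} (h0 : j ≠ 0) (h1 : j ≠ 1) :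
    twistedShift c j = j + c := by
  simp [twistedShift, Equiv.swap_apply_of_ne_of_ne h0 h1]

/-- The transposition moves a row by at most one diagonal, so the twisted shift stays on diagonals
covered by the two circulant planes. -/
theorem twistedShift_cases (c j : Fin n) :
    twistedShift (c + 1) j = j + c ∨ twistedShift (c + 1) j = j + (c + 1) ∨
      twistedShift (c + 1) j = j + (c + 1 + 1) := by
  by_cases h0 : j = 0
  · right; right; rw [h0, twistedShift_zero]; abel
  by_cases h1 : j = 1
  · left; rw [h1, twistedShift_one]; abel
  · right; left; exact twistedShift_of_ne _ h0 h1

theorem eq_apply_zero_of_add_one (φ : Fin n → ℝ) (h : ∀ j, φ (j + 1) = φ j) (j : Fin n) :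
    φ j = φ 0 := by
  obtain ⟨m, rfl⟩ : ∃ m, n = m + 1 := Nat.exists_eq_succ_of_ne_zero (NeZero.ne n)
  induction j using Fin.induction with
  | zero => rfl
  | succ i ih => rw [← ih, ← h i.castSucc, Fin.coeSucc_eq_succ]

/-- Perturbations of a circulant plane with consecutive shifts are constant up to sign. -/
theorem circulantPlane_perturbation (h1 : (1 : Fin n) ≠ 0) (c : Fin n) {f : Fin n → Fin n → ℝ}
    (hf : ∀ j k, circulantPlane c (c + 1) j k = 0 → f j k = 0) (hrow : ∀ j, ∑ k, f j k = 0)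
    (hcol : ∀ k, ∑ j, f j k = 0) (j : Fin n) :
    f j (j + c) = f 0 (0 + c) ∧ f j (j + (c + 1)) = - f 0 (0 + c) := by
  -- The support is one cycle that alternates row steps and column steps, and each step reverses the
  -- sign.
  have hr : ∀ j, f j (j + c) + f j (j + (c + 1)) = 0 := fun j =>
    add_eq_zero_of_row hf hrow (by simpa using h1)
  have hc : ∀ j, f (j + 1) (j + 1 + c) + f j (j + 1 + c) = 0 := fun j =>
    add_eq_zero_of_col hf hcol (by simpa using h1) rfl (by simp only [Equiv.coe_addRight]; abel)
  have hconst := eq_apply_zero_of_add_one (fun j => f j (j + c)) (fun j => by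
    have h2 := hr j
    have h3 := hc j
    rw [show j + (c + 1) = j + 1 + c by abel] at h2
    linarith) j
  refine ⟨hconst, ?_⟩
  have := hr j
  linarith

/-- The sum of the three planes of a hub group. -/
noncomputable def hubGroup (c : Fin n) : Fin n → Fin n → ℝ := fun j k =>
  circulantPlane c (c + 1) j k + circulantPlane (c + 1 + 1) (c + 1 + 1 + 1) j k +
    twistedPlane (c + 1) (c + 1 + 1 + 1) j k

/-- A half from the twisted plane meets a half from a circulant plane. The position is thereby
exhausted inside the group, and its vertical equation involves no later plane. -/
theorem one_le_hubGroup_twisted (c j : Fin n) : 1 ≤ hubGroup c j (twistedShift (c + 1) j) := by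
  have hC := half_le_halfSum_left (twistedShift (c + 1)) (Equiv.addRight (c + 1 + 1 + 1)) j
  have hA0 := halfSum_nonneg (Equiv.addRight c) (Equiv.addRight (c + 1)) j
    (twistedShift (c + 1) j)
  have hB0 := halfSum_nonneg (Equiv.addRight (c + 1 + 1)) (Equiv.addRight (c + 1 + 1 + 1)) j
    (twistedShift (c + 1) j)
  unfold hubGroup circulantPlane twistedPlane
  rcases twistedShift_cases c j with h | h | h
  · have hA : 1 / 2 ≤ halfSum (Equiv.addRight c) (Equiv.addRight (c + 1)) j
        (twistedShift (c + 1) j) := by rw [h]; exact half_le_halfSum_left _ _ j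
    linarith
  · have hA : 1 / 2 ≤ halfSum (Equiv.addRight c) (Equiv.addRight (c + 1)) j
        (twistedShift (c + 1) j) := by rw [h]; exact half_le_halfSum_right _ _ j
    linarith
  · have hB : 1 / 2 ≤ halfSum (Equiv.addRight (c + 1 + 1)) (Equiv.addRight (c + 1 + 1 + 1)) j
        (twistedShift (c + 1) j) := by rw [h]; exact half_le_halfSum_left _ _ j
    linarith

theorem one_le_hubGroup_shift (c j : Fin n) : 1 ≤ hubGroup c j (j + (c + 1 + 1 + 1)) := by
  have hC := half_le_halfSum_right (twistedShift (c + 1)) (Equiv.addRight (c + 1 + 1 + 1)) j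
  have hA0 := halfSum_nonneg (Equiv.addRight c) (Equiv.addRight (c + 1)) j
    (j + (c + 1 + 1 + 1))
  have hB := half_le_halfSum_right (Equiv.addRight (c + 1 + 1)) (Equiv.addRight (c + 1 + 1 + 1)) j
  rw [Equiv.coe_addRight (c + 1 + 1 + 1)] at hC hB
  unfold hubGroup circulantPlane twistedPlane
  linarith

/-- A hub group admits no perturbation that cancels on the lines that it fills. -/
theorem hubGroup_rigid (h1 : (1 : Fin n) ≠ 0) (h2 : (1 + 1 : Fin n) ≠ 0)
    (h3 : (1 + 1 + 1 : Fin n) ≠ 0) (c : Fin n) {a b e : Fin n → Fin n → ℝ}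
    (ha : ∀ j k, circulantPlane c (c + 1) j k = 0 → a j k = 0)
    (hb : ∀ j k, circulantPlane (c + 1 + 1) (c + 1 + 1 + 1) j k = 0 → b j k = 0)
    (he : ∀ j k, twistedPlane (c + 1) (c + 1 + 1 + 1) j k = 0 → e j k = 0)
    (har : ∀ j, ∑ k, a j k = 0) (hac : ∀ k, ∑ j, a j k = 0)
    (hbr : ∀ j, ∑ k, b j k = 0) (hbc : ∀ k, ∑ j, b j k = 0) (her : ∀ j, ∑ k, e j k = 0)
    (hsum : ∀ j k, 1 ≤ hubGroup c j k → a j k + b j k + e j k = 0) :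
    (∀ j k, a j k = 0) ∧ (∀ j k, b j k = 0) ∧ (∀ j k, e j k = 0) := by
  have hA := circulantPlane_perturbation h1 c ha har hac
  have hB := circulantPlane_perturbation h1 (c + 1 + 1) hb hbr hbc
  set x := a 0 (0 + c)
  set y := b 0 (0 + (c + 1 + 1))
  have h2' : (1 + (1 + 1) : Fin n) ≠ 0 := by rwa [← add_assoc]
  have hb0 : ∀ j, b j (j + c) = 0 := fun j => hb _ _ (halfSum_eq_zero _ _
    (by simp [add_assoc, h2]) (by simp [add_assoc, h2']))
  have hb1 : ∀ j, b j (j + (c + 1)) = 0 := fun j => hb _ _ (halfSum_eq_zero _ _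
    (by simp [h1]) (by simp [add_assoc, h2]))
  have ha3 : ∀ j, a j (j + (c + 1 + 1 + 1)) = 0 := fun j => ha _ _ (halfSum_eq_zero _ _
    (by simp [add_assoc, h2']) (by simp [add_assoc, h2]))
  have hne : ∀ j, twistedShift (c + 1) j ≠ Equiv.addRight (c + 1 + 1 + 1) j := by
    intro j
    rcases twistedShift_cases c j with h | h | h <;> rw [h] <;>
      simp [add_assoc, h1, h2, h2']
  have hrow : ∀ j, e j (twistedShift (c + 1) j) + e j (j + (c + 1 + 1 + 1)) = 0 := fun j =>
    add_eq_zero_of_row he her (hne j)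
  -- On the last diagonal the first plane vanishes and the second carries `-y`.
  have he3 : ∀ j, e j (j + (c + 1 + 1 + 1)) = y := by
    intro j
    have := hsum _ _ (one_le_hubGroup_shift c j)
    rw [ha3, (hB j).2] at this
    linarith
  -- Row `1 + 1` is not moved by the transposition: its twisted entry lies on diagonal `c + 1`,
  -- where the first plane carries `-x`.
  have hxy : x + y = 0 := by
    have ht := twistedShift_of_ne (c + 1) (j := 1 + 1) h2 (by simpa using h1)
    have h := hsum _ _ (one_le_hubGroup_twisted c (1 + 1))
    rw [ht, (hA _).2, hb1] at h
    have hr := hrow (1 + 1)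
    rw [ht, he3] at hr
    linarith
  -- In row `1` the transposition moves the twisted entry to diagonal `c`, where the first plane
  -- carries `+x`. The opposite sign forces `x = y = 0`.
  have hxy' : -x + y = 0 := by
    have ht : twistedShift (c + 1) 1 = 1 + c := by rw [twistedShift_one]; abel
    have h := hsum _ _ (one_le_hubGroup_twisted c 1)
    rw [ht, (hA _).1, hb0] at h
    have hr := hrow 1
    rw [ht, he3] at hr
    linarith
  have hx : x = 0 := by linarith
  have hy : y = 0 := by linarith
  have ha0 : ∀ j k, a j k = 0 := by
    intro j k
    by_cases e1 : j + c = k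
    · rw [← e1, (hA j).1, hx]
    by_cases e2 : j + (c + 1) = k
    · rw [← e2, (hA j).2, hx, neg_zero]
    exact ha _ _ (halfSum_eq_zero _ _ e1 e2)
  have hb0' : ∀ j k, b j k = 0 := by
    intro j k
    by_cases e1 : j + (c + 1 + 1) = k
    · rw [← e1, (hB j).1, hy]
    by_cases e2 : j + (c + 1 + 1 + 1) = k
    · rw [← e2, (hB j).2, hy, neg_zero]
    exact hb _ _ (halfSum_eq_zero _ _ e1 e2)
  refine ⟨ha0, hb0', fun j k => ?_⟩
  have he0 := he3 j
  rw [hy] at he0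
  by_cases e1 : twistedShift (c + 1) j = k
  · have := hrow j
    rw [he0, add_zero] at this
    rw [← e1, this]
  by_cases e2 : j + (c + 1 + 1 + 1) = k
  · rw [← e2, he0]
  exact he _ _ (halfSum_eq_zero _ _ e1 e2)

/-- The family obtained by putting a hub group in front of a family of matrices. -/
noncomputable def consHubGroup {L : ℕ} (c : Fin n) (l : Fin L → Fin n → Fin n → ℝ) :
    Fin (L + 3) → Fin n → Fin n → ℝ :=
  Fin.cons (circulantPlane c (c + 1)) (Fin.cons (circulantPlane (c + 1 + 1) (c + 1 + 1 + 1))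
    (Fin.cons (twistedPlane (c + 1) (c + 1 + 1 + 1)) l : Fin (L + 1) → Fin n → Fin n → ℝ) :
      Fin (L + 2) → Fin n → Fin n → ℝ)

theorem consHubGroup_injective {L : ℕ} (c : Fin n) :
    Function.Injective (consHubGroup (L := L) c) := by
  intro l l' h
  exact ((Fin.cons_inj.mp (Fin.cons_inj.mp (Fin.cons_inj.mp h).2).2).2)

/-- Where the group reaches `1` nothing of `D ≤ 1` is left, so later planes vanish and
`hubGroup_rigid` applies to the first three planes alone; the rest is rigid by hypothesis. -/
theorem IsRigidFilling.consHubGroup (h1 : (1 : Fin n) ≠ 0) (h2 : (1 + 1 : Fin n) ≠ 0)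
    (h3 : (1 + 1 + 1 : Fin n) ≠ 0) {L : ℕ} {D : Fin n → Fin n → ℝ} (c : Fin n)
    (hD : ∀ j k, D j k ≤ 1) {l : Fin L → Fin n → Fin n → ℝ}
    (hl : IsRigidFilling (fun j k => D j k - hubGroup c j k) l) :
    IsRigidFilling D (consHubGroup c l) where
  nonneg i := by
    refine Fin.cases (halfSum_nonneg _ _) (fun i => ?_) i
    refine Fin.cases (halfSum_nonneg _ _) (fun i => ?_) i
    exact Fin.cases (halfSum_nonneg _ _) (fun i => hl.nonneg i) i
  row i := by
    refine Fin.cases (halfSum_row _ _) (fun i => ?_) i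
    refine Fin.cases (halfSum_row _ _) (fun i => ?_) i
    exact Fin.cases (halfSum_row _ _) (fun i => hl.row i) i
  col i := by
    refine Fin.cases (halfSum_col _ _) (fun i => ?_) i
    refine Fin.cases (halfSum_col _ _) (fun i => ?_) i
    exact Fin.cases (halfSum_col _ _) (fun i => hl.col i) i
  sum j k := by
    unfold _root_.consHubGroup
    rw [Fin.sum_univ_succ, Fin.sum_univ_succ, Fin.sum_univ_succ]
    simp only [Fin.cons_zero, Fin.cons_succ, hl.sum, hubGroup]
    ring
  rigid f hf hrow hcol hsum := by
    have hs : ∀ j k, f 0 j k + f (Fin.succ 0) j k + f (Fin.succ (Fin.succ 0)) j k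
        + ∑ i : Fin L, f i.succ.succ.succ j k = 0 := by
      intro j k
      have := hsum j k
      rw [Fin.sum_univ_succ, Fin.sum_univ_succ, Fin.sum_univ_succ] at this
      linarith
    have hft : ∀ i j k, l i j k = 0 → f i.succ.succ.succ j k = 0 :=
      fun i j k h => hf i.succ.succ.succ j k h
    obtain ⟨ha, hb, he⟩ := hubGroup_rigid h1 h2 h3 c (hf 0) (hf (Fin.succ 0))
      (hf (Fin.succ (Fin.succ 0))) (hrow 0) (hcol 0) (hrow _) (hcol _) (hrow _)
      (fun j k h => by
        have := hs j k
        rwa [Finset.sum_eq_zero fun i _ => hft i j k (hl.eq_zero_of_nonpos (by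
          have := hD j k
          linarith) i), add_zero] at this)
    have ht := hl.rigid (fun i => f i.succ.succ.succ) hft (fun i => hrow _) (fun i => hcol _)
      (fun j k => by
        have := hs j k
        rwa [ha, hb, he, add_zero, add_zero, zero_add] at this)
    intro i
    refine Fin.cases ha (fun i => ?_) i
    refine Fin.cases hb (fun i => ?_) i
    exact Fin.cases he ht i

/-- The matrix that remains after `t` hub groups on the first `4 t` cyclic diagonals. -/
structure IsHubRemainder (D : Fin n → Fin n → ℝ) (t : ℕ) : Prop where
  values : ∀ j k, D j k = 0 ∨ D j k = 1 / 2 ∨ D j k = 1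
  one : ∀ j k, D j k = 1 ↔ 4 * t ≤ (k - j).val
  rowSum : ∀ j, ∑ k, D j k = n - 3 * t
  colSum : ∀ k, ∑ j, D j k = n - 3 * t

theorem card_filter_le_val {m : ℕ} (t : ℕ) (ht : t ≤ m) :
    (Finset.univ.filter fun i : Fin m => t ≤ i.val).card = m - t := by
  have h := Finset.card_filter_add_card_filter_not (s := (Finset.univ : Finset (Fin m)))
    (fun i : Fin m => i.val < t)
  rw [Fin.card_filter_val_lt, Finset.card_univ, Fintype.card_fin, min_eq_right ht] at h
  simp only [not_lt] at h
  omega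

/-- The line sum `n - 3t` exceeds the contribution `n - 4t` of the ones by `t`, that is, by `2t`
halves. -/
theorem IsHubRemainder.isHalfRegular {D : Fin n → Fin n → ℝ} {t : ℕ} (hD : IsHubRemainder D t)
    (ht : 4 * t ≤ n) : IsHalfRegular D (2 * t) (n - 4 * t) := by
  have hc : (((n - 4 * t : ℕ) : ℝ)) + ((2 * t : ℕ) : ℝ) / 2 = n - 3 * t := by
    rw [Nat.cast_sub ht]; push_cast; ring
  refine ⟨hD.values, fun j => ?_, fun k => ?_, fun j => by rw [hc, hD.rowSum],
    fun k => by rw [hc, hD.colSum]⟩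
  · simp only [hD.one]
    rw [← card_filter_le_val (4 * t) ht]
    exact Finset.card_equiv (Equiv.subRight j) (by simp)
  · simp only [hD.one]
    rw [← card_filter_le_val (4 * t) ht]
    exact Finset.card_equiv (Equiv.subLeft k) (by simp)

theorem IsHubRemainder.sub {D : Fin n → Fin n → ℝ} {t : ℕ} (hD : IsHubRemainder D t)
    (ht : 4 * t + 4 ≤ n) (c : Fin n) (hc : c.val = 4 * t) :
    IsHubRemainder (fun j k => D j k - hubGroup c j k) (t + 1) := by
  have hv : ∀ x : Fin n, x.val + 1 < n → (x + 1).val = x.val + 1 := by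
    intro x hx
    rw [Fin.val_add, Fin.val_one', Nat.mod_eq_of_lt (show 1 < n by omega), Nat.mod_eq_of_lt hx]
  have hc1 : (c + 1).val = 4 * t + 1 := by rw [hv _ (by omega), hc]
  have hc2 : (c + 1 + 1).val = 4 * t + 2 := by rw [hv _ (by omega), hc1]
  have hc3 : (c + 1 + 1 + 1).val = 4 * t + 3 := by rw [hv _ (by omega), hc2]
  have hiff : ∀ (j k x : Fin n), j + x = k ↔ (k - j).val = x.val := by
    intro j k x
    rw [← Fin.ext_iff, sub_eq_iff_eq_add', eq_comm]
  have htw : ∀ j k, twistedShift (c + 1) j = k →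
      (k - j).val = 4 * t ∨ (k - j).val = 4 * t + 1 ∨ (k - j).val = 4 * t + 2 := by
    rintro j k rfl
    rcases twistedShift_cases c j with h | h | h <;> rw [h] <;> simp [hc, hc1, hc2]
  have hout : ∀ j k, ¬ (4 * t ≤ (k - j).val ∧ (k - j).val < 4 * t + 4) → hubGroup c j k = 0 := by
    intro j k h
    have hnt : ¬ twistedShift (c + 1) j = k := fun h' => by
      have := htw j k h'; omega
    simp only [hubGroup, circulantPlane, twistedPlane, halfSum, Equiv.coe_addRight, hiff, hc, hc1,
      hc2, hc3, hnt, if_false]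
    rw [if_neg (by omega), if_neg (by omega), if_neg (by omega), if_neg (by omega)]
    norm_num
  -- On its four diagonals the group takes `1/2` or `1` everywhere, so the ones there turn into
  -- halves or zeros.
  have hin : ∀ j k, 4 * t ≤ (k - j).val → (k - j).val < 4 * t + 4 →
      hubGroup c j k = 1 / 2 ∨ hubGroup c j k = 1 := by
    intro j k h1 h2
    have h := htw j k
    simp only [hubGroup, circulantPlane, twistedPlane, halfSum, Equiv.coe_addRight, hiff, hc, hc1,
      hc2, hc3]
    obtain e | e | e | e : (k - j).val = 4 * t ∨ (k - j).val = 4 * t + 1 ∨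
        (k - j).val = 4 * t + 2 ∨ (k - j).val = 4 * t + 3 := by omega
    · by_cases hk : twistedShift (c + 1) j = k <;> simp only [e, hk] <;> norm_num
    · by_cases hk : twistedShift (c + 1) j = k <;> simp only [e, hk] <;> norm_num
    · by_cases hk : twistedShift (c + 1) j = k <;> simp only [e, hk] <;> norm_num
    · have hnt : ¬ twistedShift (c + 1) j = k := fun h' => by have := h h'; omega
      simp only [e, hnt]; norm_num
  have hrow : ∀ j, ∑ k, hubGroup c j k = 3 := by
    intro j
    simp only [hubGroup, Finset.sum_add_distrib, circulantPlane, twistedPlane, halfSum_row]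
    norm_num
  have hcol : ∀ k, ∑ j, hubGroup c j k = 3 := by
    intro k
    simp only [hubGroup, Finset.sum_add_distrib, circulantPlane, twistedPlane, halfSum_col]
    norm_num
  refine ⟨fun j k => ?_, fun j k => ?_, fun j => ?_, fun k => ?_⟩
  · by_cases h : 4 * t ≤ (k - j).val ∧ (k - j).val < 4 * t + 4
    · rw [(hD.one j k).mpr h.1]
      rcases hin j k h.1 h.2 with e | e <;> rw [e] <;> norm_num
    · simpa [hout j k h] using hD.values j k
  · by_cases h : 4 * t ≤ (k - j).val ∧ (k - j).val < 4 * t + 4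
    · rw [(hD.one j k).mpr h.1]
      have : ¬ 4 * (t + 1) ≤ (k - j).val := by omega
      rcases hin j k h.1 h.2 with e | e <;> rw [e] <;> simp only [this] <;> norm_num
    · rw [hout j k h, sub_zero, hD.one]
      omega
  · rw [Finset.sum_sub_distrib, hD.rowSum, hrow]; push_cast; ring
  · rw [Finset.sum_sub_distrib, hD.colSum, hcol]; push_cast; ring

/-- The hub groups are fixed and only prepare the halves; all choices come from the `n - 4g` generic
planes. The term `3 * r` in `L` counts the planes of the `r` groups still to be placed. -/
theorem IsHubRemainder.exists_many_fillings (hn : 4 ≤ n) (g : ℕ) (hg : 4 * g ≤ n) :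
    ∀ (r t : ℕ), t + r = g → ∀ D : Fin n → Fin n → ℝ, IsHubRemainder D t →
    ∀ L, L = (n - 4 * g) + g + 3 * r →
    ∃ s : Finset (Fin L → Fin n → Fin n → ℝ), (∀ l ∈ s, IsRigidFilling D l) ∧
      ∏ i ∈ Finset.range (n - 4 * g), ((((2 * g : ℕ) : ℝ) / Real.exp 1) ^ n *
        (((i + 1 : ℕ) : ℝ) / Real.exp 1) ^ n) ≤ (s.card : ℝ)
  | 0, t, htr, D, hD, L, hL => by
    obtain rfl : t = g := by omega
    exact _root_.exists_many_fillings t _ L (by omega) D (hD.isHalfRegular hg)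
  | r + 1, t, htr, D, hD, L, hL => by
    classical
    obtain ⟨L, rfl⟩ : ∃ M, L = M + 3 := ⟨(n - 4 * g) + g + 3 * r, by omega⟩
    obtain ⟨c, hc⟩ : ∃ c : Fin n, c.val = 4 * t := ⟨⟨4 * t, by omega⟩, rfl⟩
    obtain ⟨s, hs, hcard⟩ := IsHubRemainder.exists_many_fillings hn g hg r (t + 1) (by omega) _
      (hD.sub (by omega) c hc) L (by omega)
    have hone : (1 : Fin n).val = 1 := by
      rw [Fin.val_one', Nat.mod_eq_of_lt (by omega)]
    have htwo : (1 + 1 : Fin n).val = 2 := by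
      rw [Fin.val_add, hone, Nat.mod_eq_of_lt (by omega)]
    have hthree : (1 + 1 + 1 : Fin n).val = 3 := by
      rw [Fin.val_add, htwo, hone, Nat.mod_eq_of_lt (by omega)]
    refine ⟨s.image (consHubGroup c), fun l hl => ?_, ?_⟩
    · obtain ⟨l', hl', rfl⟩ := Finset.mem_image.mp hl
      refine (hs l' hl').consHubGroup (fun h => ?_) (fun h => ?_) (fun h => ?_) c (fun j k => ?_)
      · rw [h] at hone; simp at hone
      · rw [h] at htwo; simp at htwo
      · rw [h] at hthree; simp at hthree
      · rcases hD.values j k with h | h | h <;> rw [h] <;> norm_num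
    · rwa [Finset.card_image_of_injective _ (consHubGroup_injective c)]

end Hub

/-- The all-ones matrix of order `n` has many rigid fillings by `n` matrices. -/
theorem exists_many_rigidFillings {n : ℕ} (hn : 4 ≤ n) (g : ℕ) (hg : 4 * g ≤ n) :
    ∃ s : Finset (Fin n → Fin n → Fin n → ℝ), (∀ l ∈ s, IsRigidFilling (fun _ _ => 1) l) ∧
      ∏ i ∈ Finset.range (n - 4 * g), ((((2 * g : ℕ) : ℝ) / Real.exp 1) ^ n *
        (((i + 1 : ℕ) : ℝ) / Real.exp 1) ^ n) ≤ (s.card : ℝ) := by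
  have : NeZero n := ⟨by omega⟩
  exact IsHubRemainder.exists_many_fillings hn g hg g 0 (by omega) _
    ⟨fun _ _ => by norm_num, fun _ _ => by simp, fun _ => by simp, fun _ => by simp⟩ n (by omega)

/-! ### Vertices of the polytope. -/

/-- A tristochastic array that admits no nonzero perturbation supported on its support with all
line sums zero is a vertex. -/
theorem mem_tristochasticVertices_of_rigid {n : ℕ} {A : Fin n → Fin n → Fin n → ℝ}
    (hA : A ∈ tristochasticPolytope n)
    (hrigid : ∀ f : Fin n → Fin n → Fin n → ℝ, (∀ i j k, A i j k = 0 → f i j k = 0) →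
      (∀ i j, ∑ k, f i j k = 0) → (∀ i k, ∑ j, f i j k = 0) → (∀ j k, ∑ i, f i j k = 0) →
      ∀ i j k, f i j k = 0) :
    A ∈ tristochasticVertices n := by
  refine mem_extremePoints_iff_left.mpr ⟨hA, fun B hB C hC hseg => ?_⟩
  obtain ⟨a, b, ha, hb, -, rfl⟩ := hseg
  -- If `A` lies strictly between `B` and `C`, nonnegativity makes `B` vanish wherever `A` does, so
  -- `B - A` is an admissible perturbation.
  have h := hrigid (B - (a • B + b • C)) (fun i j k h => ?_) (fun i j => ?_) (fun i k => ?_)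
    (fun j k => ?_)
  · ext i j k
    exact sub_eq_zero.mp (h i j k)
  · simp only [Pi.add_apply, Pi.smul_apply, smul_eq_mul, Pi.sub_apply] at h ⊢
    have h1 := mul_nonneg ha.le (hB.1 i j k)
    have h2 := mul_nonneg hb.le (hC.1 i j k)
    have h3 : a * B i j k = 0 := by linarith
    rw [h, (mul_eq_zero.mp h3).resolve_left ha.ne', sub_zero]
  · simp only [Pi.sub_apply, Finset.sum_sub_distrib, hB.2.2.2, hA.2.2.2, sub_self]
  · simp only [Pi.sub_apply, Finset.sum_sub_distrib, hB.2.2.1, hA.2.2.1, sub_self]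
  · simp only [Pi.sub_apply, Finset.sum_sub_distrib, hB.2.1, hA.2.1, sub_self]

theorem IsRigidFilling.mem_tristochasticVertices {n : ℕ} {A : Fin n → Fin n → Fin n → ℝ}
    (hA : IsRigidFilling (fun _ _ => 1) A) : A ∈ tristochasticVertices n :=
  mem_tristochasticVertices_of_rigid ⟨hA.nonneg, hA.sum, hA.col, hA.row⟩ hA.rigid

theorem sum_ite_of_existsUnique {n : ℕ} {p : Fin n → Prop} [DecidablePred p] (h : ∃! i, p i) :
    ∑ i, (if p i then (1 : ℝ) else 0) = 1 := by
  obtain ⟨i, hi, hu⟩ := h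
  rw [Finset.sum_eq_single i (fun j _ hj => if_neg fun h => hj (hu j h)) (by simp), if_pos hi]

/-- Each line in the `k` direction meets the support once, so its zero sum already kills a
perturbation. -/
theorem toArray_mem_tristochasticVertices {n : ℕ} {L : Fin n → Fin n → Fin n}
    (hL : IsLatinSquare L) : toArray L ∈ tristochasticVertices n := by
  refine mem_tristochasticVertices_of_rigid ⟨fun i j k => ?_, fun j k => ?_, fun i k => ?_,
    fun i j => ?_⟩ fun f hf hrow _ _ i j k => ?_
  · unfold toArray; split_ifs <;> norm_num
  · exact sum_ite_of_existsUnique (hL.2 j k)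
  · exact sum_ite_of_existsUnique (hL.1 i k)
  · simp [toArray]
  · have hne : ∀ k, L i j ≠ k → f i j k = 0 := fun k h => hf i j k (if_neg h)
    by_cases h : L i j = k
    · have := hrow i j
      rwa [Finset.sum_eq_single (L i j) (fun k _ h => hne k h.symm) (by simp), h] at this
    · exact hne k h

theorem latinSquareArrays_subset (n : ℕ) : latinSquareArrays n ⊆ tristochasticVertices n := by
  rintro _ ⟨L, hL, rfl⟩
  exact toArray_mem_tristochasticVertices hL

/-- A vertex is determined by its support. -/
theorem eq_of_support_eq {n : ℕ} {A B : Fin n → Fin n → Fin n → ℝ}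
    (hA : A ∈ tristochasticVertices n) (hB : B ∈ tristochasticPolytope n)
    (h : ∀ i j k, A i j k = 0 → B i j k = 0) : B = A := by
  obtain ⟨hAP, hext⟩ := mem_extremePoints_iff_left.mp hA
  have hev : ∀ᶠ δ : ℝ in nhdsWithin 0 (Set.Ioi 0), ∀ i j k, δ * B i j k ≤ A i j k := by
    refine Filter.eventually_all.mpr fun i => Filter.eventually_all.mpr fun j =>
      Filter.eventually_all.mpr fun k => ?_
    by_cases h0 : A i j k = 0
    · simp [h0, h i j k h0]
    · have hpos : 0 < A i j k := lt_of_le_of_ne (hAP.1 i j k) (Ne.symm h0)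
      have hc : Filter.Tendsto (fun δ : ℝ => δ * B i j k) (nhdsWithin 0 (Set.Ioi 0))
          (nhds (0 * B i j k)) :=
        ((continuous_id.mul continuous_const).tendsto 0).mono_left nhdsWithin_le_nhds
      rw [zero_mul] at hc
      filter_upwards [hc.eventually_lt_const hpos] with δ hδ using hδ.le
  obtain ⟨δ, hδ, hδ0⟩ := (hev.and self_mem_nhdsWithin).exists
  have hδ0 : 0 < δ := hδ0
  -- The segment from `B` to `A` is prolonged slightly beyond `A`; the choice of `δ` keeps it
  -- nonnegative. Extremality of `A` then gives `B = A`.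
  refine hext B hB (fun i j k => A i j k + δ * (A i j k - B i j k)) ⟨fun i j k => ?_, fun j k => ?_,
    fun i k => ?_, fun i j => ?_⟩ ⟨δ / (1 + δ), 1 / (1 + δ), by positivity, by positivity,
      by field_simp; ring, ?_⟩
  · have h1 := hδ i j k
    have h2 := mul_nonneg hδ0.le (hAP.1 i j k)
    linarith
  · rw [Finset.sum_add_distrib, ← Finset.mul_sum, Finset.sum_sub_distrib, hAP.2.1, hB.2.1]; ring
  · rw [Finset.sum_add_distrib, ← Finset.mul_sum, Finset.sum_sub_distrib, hAP.2.2.1, hB.2.2.1]; ring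
  · rw [Finset.sum_add_distrib, ← Finset.mul_sum, Finset.sum_sub_distrib, hAP.2.2.2, hB.2.2.2]; ring
  · ext i j k
    simp only [Pi.add_apply, Pi.smul_apply, smul_eq_mul]
    field_simp
    ring

/-- Distinct vertices have distinct zero patterns. Finiteness matters because `Set.ncard` is `0` on
infinite sets. -/
theorem tristochasticVertices_finite (n : ℕ) : (tristochasticVertices n).Finite := by
  classical
  refine Set.Finite.of_finite_image (f := fun A : Fin n → Fin n → Fin n → ℝ =>
    fun i j k => decide (A i j k = 0)) (Set.toFinite _) ?_
  intro A hA B hB hAB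
  refine (eq_of_support_eq hA hB.1 fun i j k h => ?_).symm
  have := congrFun (congrFun (congrFun hAB i) j) k
  simpa [h] using this

theorem exists_isLatinSquare (n : ℕ) : ∃ L : Fin n → Fin n → Fin n, IsLatinSquare L := by
  rcases Nat.eq_zero_or_pos n with rfl | hn
  · exact ⟨fun i => i.elim0, fun i => i.elim0, fun i => i.elim0⟩
  · have : NeZero n := ⟨hn.ne'⟩
    refine ⟨fun i j => i + j, fun i k => ⟨k - i, by simp, fun j hj => ?_⟩,
      fun j k => ⟨k - j, by simp, fun i hi => ?_⟩⟩
    · exact eq_sub_of_add_eq' hj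
    · exact eq_sub_of_add_eq hi

theorem one_le_ncard_tristochasticVertices (n : ℕ) : 1 ≤ (tristochasticVertices n).ncard := by
  obtain ⟨L, hL⟩ := exists_isLatinSquare n
  exact (Set.ncard_pos (tristochasticVertices_finite n)).mpr
    ⟨_, toArray_mem_tristochasticVertices hL⟩

theorem latinSquareCount_le (n : ℕ) : latinSquareCount n ≤ (n ^ n) ^ n := by
  refine (Set.ncard_le_ncard (Set.subset_univ _) (Set.toFinite _)).trans ?_
  rw [Set.ncard_univ, Nat.card_eq_fintype_card]
  simp

theorem ncard_latinSquareArrays_le (n : ℕ) : (latinSquareArrays n).ncard ≤ (n ^ n) ^ n :=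
  (Set.ncard_image_le (Set.toFinite _)).trans (latinSquareCount_le n)

/-! ### Asymptotic comparison. -/

/-- For large `n` the number of vertices is at least `n ^ (3 n² / 2)`. -/
theorem pow_six_le_ncard_tristochasticVertices {n : ℕ} (hn : 2048 ^ 4 ≤ n) :
    (((n : ℝ) ^ n) ^ n) ^ 6 ≤ ((tristochasticVertices n).ncard : ℝ) ^ 4 := by
  -- With this `g` the number `d` of generic planes is at least `7n/8`, for a leading exponent `2dn
  -- ≥ 7n²/4 > 3n²/2`.
  obtain ⟨g, hg⟩ : ∃ g, g = n / 32 := ⟨_, rfl⟩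
  have hg0 : n ≤ 64 * g := by omega
  have hg1 : 32 * g ≤ n := by omega
  obtain ⟨s, hs, hcard⟩ := exists_many_rigidFillings (n := n) (by omega) g (by omega)
  obtain ⟨d, hd⟩ : ∃ d, d = n - 4 * g := ⟨_, rfl⟩
  rw [← hd] at hcard
  have hd1 : 7 * n ≤ 8 * d := by omega
  have hle : (s.card : ℝ) ≤ ((tristochasticVertices n).ncard : ℝ) := by
    rw [← Set.ncard_coe_finset s]
    exact_mod_cast Set.ncard_le_ncard (fun l hl => (hs l hl).mem_tristochasticVertices)
      (tristochasticVertices_finite n)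
  have hnR : (2048 : ℝ) ^ 4 ≤ n := by exact_mod_cast hn
  have hn1 : (1 : ℝ) ≤ n := le_trans (by norm_num) hnR
  have hgR : (n : ℝ) ≤ 64 * g := by exact_mod_cast hg0
  have hdR : 7 * (n : ℝ) ≤ 8 * d := by exact_mod_cast hd1
  have he : Real.exp 1 ^ 3 ≤ 32 := by
    have h := Real.exp_one_lt_d9.le
    calc Real.exp 1 ^ 3 ≤ 2.7182818286 ^ 3 := by gcongr
      _ ≤ 32 := by norm_num
  have hfac : ((d : ℝ) / Real.exp 1) ^ d ≤ d.factorial := by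
    have h := Real.pow_div_factorial_le_exp (d : ℝ) (by positivity) d
    rw [div_le_iff₀ (by positivity)] at h
    rw [div_pow, div_le_iff₀ (by positivity), ← Real.exp_nat_mul, mul_one]
    linarith
  -- the product, without the exponent `n`
  have hY : ((n : ℝ) ^ 2 / 2048) ^ d ≤
      ∏ i ∈ Finset.range d, ((((2 * g : ℕ) : ℝ) / Real.exp 1) * (((i + 1 : ℕ) : ℝ) / Real.exp 1)) := by
    have e : ∏ i ∈ Finset.range d,
        ((((2 * g : ℕ) : ℝ) / Real.exp 1) * (((i + 1 : ℕ) : ℝ) / Real.exp 1))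
        = (2 * g / Real.exp 1 ^ 2) ^ d * d.factorial := by
      rw [Finset.prod_mul_distrib, Finset.prod_div_distrib (f := fun i => ((i + 1 : ℕ) : ℝ)),
        Finset.prod_const, Finset.prod_const, Finset.card_range, ← Nat.cast_prod,
        Finset.prod_range_add_one_eq_factorial]
      push_cast
      rw [div_pow, div_pow, ← pow_mul, two_mul d, pow_add]
      field_simp
    rw [e]
    calc ((n : ℝ) ^ 2 / 2048) ^ d ≤ (2 * g / Real.exp 1 ^ 2 * (d / Real.exp 1)) ^ d := by
          gcongr
          have e2 : 2 * (g : ℝ) / Real.exp 1 ^ 2 * (d / Real.exp 1)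
              = (2 * g * d) / Real.exp 1 ^ 3 := by field_simp
          rw [e2, le_div_iff₀ (by positivity)]
          have h2 : (n : ℝ) * (7 * n) ≤ (64 * g) * (8 * d) := by gcongr
          nlinarith [sq_nonneg (n : ℝ), mul_le_mul_of_nonneg_left he (sq_nonneg (n : ℝ))]
      _ = (2 * g / Real.exp 1 ^ 2) ^ d * (d / Real.exp 1) ^ d := by rw [mul_pow]
      _ ≤ _ := by gcongr
  -- One of the eight powers of `n` pays for `2048 ^ 4`, hence the threshold on `n`; the remaining
  -- seven suffice because `6n ≤ 7d`.
  have hz : (n : ℝ) ^ 7 ≤ ((n : ℝ) ^ 2 / 2048) ^ 4 := by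
    rw [div_pow, le_div_iff₀ (by positivity), ← pow_mul]
    calc (n : ℝ) ^ 7 * 2048 ^ 4 ≤ (n : ℝ) ^ 7 * n := by gcongr
      _ = (n : ℝ) ^ (2 * 4) := by ring
  have hexp : (((n : ℝ) ^ n) ^ n) ^ 6 ≤ ((((n : ℝ) ^ 2 / 2048) ^ d) ^ n) ^ 4 := by
    calc (((n : ℝ) ^ n) ^ n) ^ 6 = ((n : ℝ) ^ (6 * n)) ^ n := by
          rw [← pow_mul, ← pow_mul, ← pow_mul]; congr 1; ring
      _ ≤ ((n : ℝ) ^ (7 * d)) ^ n := by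
          have : 6 * n ≤ 7 * d := by omega
          exact pow_le_pow_left₀ (by positivity) (pow_le_pow_right₀ hn1 this) n
      _ = (((n : ℝ) ^ 7) ^ d) ^ n := by rw [pow_mul (n : ℝ)]
      _ ≤ ((((n : ℝ) ^ 2 / 2048) ^ 4) ^ d) ^ n := by gcongr
      _ = _ := by
          rw [← pow_mul, ← pow_mul, ← pow_mul, ← pow_mul]; congr 1; ring
  refine hexp.trans ?_
  gcongr
  refine le_trans ?_ (hcard.trans hle)
  simp only [← mul_pow]
  rw [Finset.prod_pow]
  gcongr

theorem rpow_le_ncard_tristochasticVertices {n : ℕ} (hn : 2048 ^ 4 ≤ n) :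
    (((n : ℝ) ^ n) ^ n) ^ (3 / 2 : ℝ) ≤ ((tristochasticVertices n).ncard : ℝ) := by
  have h := pow_six_le_ncard_tristochasticVertices hn
  refine le_of_pow_le_pow_left₀ (n := 4) (by norm_num) (by positivity) (le_trans (le_of_eq ?_) h)
  rw [← Real.rpow_natCast, ← Real.rpow_mul (by positivity), ← Real.rpow_natCast _ 6]
  norm_num

theorem theorem4 :
    (∃ ε : ℕ → ℝ, Filter.Tendsto ε Filter.atTop (nhds 0) ∧
      ∀ n : ℕ, (latinSquareCount n : ℝ) ^ ((3 / 2 : ℝ) - ε n) ≤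
        ((tristochasticVertices n).ncard : ℝ)) ∧
    (∀ n : ℕ, latinSquareArrays n ⊆ tristochasticVertices n) ∧
    Filter.Tendsto
      (fun n : ℕ => ((latinSquareArrays n).ncard : ℝ) / ((tristochasticVertices n).ncard : ℝ))
      Filter.atTop (nhds 0) := by
  -- Below the threshold `ε = 3/2` makes the exponent zero, and one vertex is enough; above it no
  -- error term is needed.
  refine ⟨⟨fun n => if 2048 ^ 4 ≤ n then 0 else 3 / 2, ?_, fun n => ?_⟩,
    latinSquareArrays_subset, ?_⟩
  · refine tendsto_const_nhds.congr' ?_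
    filter_upwards [Filter.eventually_ge_atTop (2048 ^ 4)] with n hn
    rw [if_pos hn]
  · by_cases hn : 2048 ^ 4 ≤ n
    · simp only [if_pos hn, sub_zero]
      refine le_trans ?_ (rpow_le_ncard_tristochasticVertices hn)
      gcongr
      exact_mod_cast latinSquareCount_le n
    · simp only [if_neg hn, sub_self, Real.rpow_zero]
      exact_mod_cast one_le_ncard_tristochasticVertices n
  · have hlim : Filter.Tendsto (fun n : ℕ => (n : ℝ) ^ (-(1 / 2 : ℝ))) Filter.atTop (nhds 0) :=
      (tendsto_rpow_neg_atTop (by norm_num)).comp tendsto_natCast_atTop_atTop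
    refine squeeze_zero' (Filter.Eventually.of_forall fun n => by positivity) ?_ hlim
    filter_upwards [Filter.eventually_ge_atTop (2048 ^ 4)] with n hn
    have hn1 : (1 : ℝ) ≤ n := by exact_mod_cast le_trans (by norm_num) hn
    have hn0 : n ≠ 0 := by rintro rfl; norm_num at hn
    have hnpos : (0 : ℝ) < n := by linarith
    have hT : (n : ℝ) ≤ ((n : ℝ) ^ n) ^ n :=
      (le_self_pow₀ hn1 hn0).trans (le_self_pow₀ (one_le_pow₀ hn1) hn0)
    have hv := rpow_le_ncard_tristochasticVertices hn
    have hL : ((latinSquareArrays n).ncard : ℝ) ≤ ((n : ℝ) ^ n) ^ n := by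
      exact_mod_cast ncard_latinSquareArrays_le n
    set T : ℝ := ((n : ℝ) ^ n) ^ n
    have hT0 : 0 < T := by linarith
    have hvpos : (0 : ℝ) < ((tristochasticVertices n).ncard : ℝ) :=
      lt_of_lt_of_le (by positivity) hv
    rw [div_le_iff₀ hvpos, Real.rpow_neg hnpos.le, inv_mul_eq_div, le_div_iff₀ (by positivity)]
    -- With `T = n ^ (n²)`, the proportion is at most `T / T ^ (3/2) = T ^ (-1/2) ≤ n ^ (-1/2)`.
    calc ((latinSquareArrays n).ncard : ℝ) * (n : ℝ) ^ (1 / 2 : ℝ) ≤ T * T ^ (1 / 2 : ℝ) := by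
          gcongr
      _ = T ^ (3 / 2 : ℝ) := by
          rw [← Real.rpow_one_add' hT0.le (by norm_num)]; norm_num
      _ ≤ _ := hv
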